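/- Let $k\subset S^3$ be a knot, given by an oriented planar diagram with at least one crossing, with exterior $K$ and Wirtinger presentation $\pi_1K=\langle a_1,\dots,a_n\mid r_1,\dots,r_m\rangle$, in which the $a_i$ are the meridians of the arcs of the diagram and there is one relator for each crossing except one (the omitted relator is a consequence of the others). Let $k^\natural=k\cup\ell$ be the connected sum of $k$ with the Hopf link and $K^\natural$ its exterior, so that, for $a_1$ the meridian of the arc at which the sum is made and $b$ the meridian of $\ell$, $$\pi_1K^\natural=\langle a_1,\dots,a_n,b\mid r_1,\dots,r_m,\,[a_1,b]=1\rangle .$$ Let $c:\pi_1K^\natural\times\pi_1K^\natural\to\{\pm1\}$ be a 2-cocycle. A projective representation with cocycle $c$ is a map $\rho:\pi_1K^\natural\to SU(2)$ with $\rho(gh)\rho(h)^{-1}\rho(g)^{-1}=c(g,h)$ for all $g,h$. Let $\mathcal{PR}_c(K^\natural,SU(2))$ be the space of conjugacy classes of such maps (the quotient of the topology of pointwise convergence). A character $\chi\in H^1(K^\natural;\mathbb Z/2)=\operatorname{Hom}(\pi_1K^\natural,\{\pm1\})$ acts on it by $[\rho]\mapsto[\chi\cdot\rho]$. Let $\chi_k$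 be the character with $\chi_k(a_i)=-1$ for all $i$ and $\chi_k(b)=1$, and $\chi_\ell$ the one with $\chi_\ell(a_i)=1$ for all $i$ and $\chi_\ell(b)=-1$. Let $\mathcal R_0(K,SO(3))$ be the set of conjugacy classes of representations $\pi_1K\to SO(3)$ that send all meridians to matrices of trace $-1$. Such a representation is called reducible if its image lies in a conjugate of $SO(2)\subset SO(3)$, and dihedral if its image lies in a conjugate of the copy of $O(2)$ embedded in $SO(3)$ by $A\mapsto(A,\det A)$. Let $\psi$ send $[\rho]\in\mathcal{PR}_c(K^\natural,SU(2))$ to the conjugacy class of the representation $\pi_1K\to SO(3)$, $a_i\mapsto\operatorname{Ad}\rho(a_i)$. Then $H^1(K^\natural;\mathbb Z/2)\cong\mathbb Z/2\oplus\mathbb Z/2$ with basis $\chi_k,\chi_\ell$, there is exactly one non-zero class in $H^2(\pi_1K^\natural;\mathbb Z/2)$, and for every cocycle $c$ in this class the following holds. The group $H^1(K^\natural;\mathbb Z/2)$ acts on $\mathcal{PR}_c(K^\natural,SU(2))$ by homeomorphisms, preserving the fibers of $\psi$; and $\psi$ maps onto $\mathcal R_0(K,SO(3))$. Furthermore: (a)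 There is exactly one reducible class in $\mathcal R_0(K,SO(3))$. Its fiber under $\psi$ consists of just one point, the conjugacy class of the special projective representation $\alpha$, which agrees up to signs with the homomorphism of the free group on $a_1,\dots,a_n,b$ that sends all $a_i$ to $i$ and $b$ to $j$. This point is fixed by both $\chi_k$ and $\chi_\ell$. (b) For any irreducible (that is, not reducible) dihedral representation in $\mathcal R_0(K,SO(3))$, the fiber of $\psi$ is a circle. In a suitable homeomorphism of this fiber with the unit circle in $\mathbb C$, $\chi_k$ is the reflection $z\mapsto z^{-1}$, which has two fixed points, and $\chi_\ell$ is the antipodal map $z\mapsto -z$. (c) For any other irreducible representation in $\mathcal R_0(K,SO(3))$, the fiber of $\psi$ is homeomorphic to the disjoint union of two circles. The homeomorphism can be chosen so that $\chi_k$ interchanges the two circles by the identity map, and $\chi_\ell$ is the antipodal map on both. -/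

import Mathlib

open Topology

noncomputable section

namespace KnotHopf

/-! ### Knots and their groups -/

/-- An oriented knot diagram (given by its signed Gauss code) with `n ≥ 1` crossings.

Travelling once along the knot one meets `2 * n` passages through crossings, numbered cyclically
by `ZMod (2 * n)`; edge `p` of the diagram runs from passage `p` to passage `p + 1`.
Every crossing is passed twice, once on the upper and once on the lower strand, and `mate`
exchanges its two passages.  `sign` is the sign of the crossing: it is `1` iff the lower strand
crosses the upper one from the right to the left.
The numbering starts at a lower passage.  Planarity is imposed in `KnotDiagram` below. -/
structure PreDiagram where
  n : ℕ
  n_pos : 0 < n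
  mate : ZMod (2 * n) → ZMod (2 * n)
  isOver : ZMod (2 * n) → Bool
  sign : ZMod (2 * n) → ℤˣ
  mate_mate : ∀ p, mate (mate p) = p
  isOver_mate : ∀ p, isOver (mate p) = !(isOver p)
  sign_mate : ∀ p, sign (mate p) = sign p
  isOver_zero : isOver 0 = false

namespace PreDiagram

variable (D : PreDiagram)

/-- At passage `p`, the other strand of the crossing goes from the right to the left of the
strand that is being followed. -/
def otherGoesLeft (p : ZMod (2 * D.n)) : Bool :=
  if D.isOver p then decide (D.sign p = 1) else decide (D.sign p = -1)

/-- A directed edge: `(e, true)` is edge `e` in the direction of the knot, `(e, false)` is the same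
edge in the opposite direction. -/
abbrev Dart : Type := ZMod (2 * D.n) × Bool

/-- Walking around the face on the left: follow a directed edge up to its end, and turn left. -/
def turnLeft : D.Dart → D.Dart
  | (e, true) =>
      if D.otherGoesLeft (e + 1) then (D.mate (e + 1), true)
      else (D.mate (e + 1) - 1, false)
  | (e, false) =>
      if D.otherGoesLeft e then (D.mate e - 1, false)
      else (D.mate e, true)

/-- The faces of the diagram: directed edges up to `turnLeft`. -/
abbrev Face : Type := Quot (fun d d' : D.Dart => D.turnLeft d = d')

/-- The arcs of the diagram: consecutive edges are joined at upper passages. -/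
abbrev Arc : Type :=
  Quot (fun e e' : ZMod (2 * D.n) => e' = e + 1 ∧ D.isOver e' = true)

/-- The arc that contains a given edge. -/
def arc (e : ZMod (2 * D.n)) : D.Arc := Quot.mk _ e

/-- The Wirtinger relator `a_o ^ ε * a_in * a_o ^ (-ε) * a_out⁻¹` at a lower passage `p`, where the
arc `in` ends and the arc `out` begins, `o` is the arc passing over, and `ε` is the sign. -/
def wirtingerRelator (p : ZMod (2 * D.n)) : FreeGroup D.Arc :=
  FreeGroup.of (D.arc (D.mate p)) ^ (D.sign p : ℤ) * FreeGroup.of (D.arc (p - 1)) *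
    FreeGroup.of (D.arc (D.mate p)) ^ (-(D.sign p : ℤ)) * (FreeGroup.of (D.arc p))⁻¹

/-- The Wirtinger relators, one for each crossing but the first; the relator at that
crossing is a consequence of the other ones and is omitted, as usual. -/
def relators : Set (FreeGroup D.Arc) :=
  {r | ∃ p, p ≠ 0 ∧ D.isOver p = false ∧ r = D.wirtingerRelator p}

/-- The knot group `π₁ K`, in its Wirtinger presentation. -/
abbrev KnotGroup : Type := PresentedGroup D.relators

/-- The generators for the link `k ♮`: the arcs of the diagram of `k`, and the meridian `b` of the
second component `ℓ`. -/
abbrev LinkGen : Type := D.Arc ⊕ Unit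

/-- The relators for the connected sum of the knot with the Hopf link: those of the knot, and
the commutator `[a₁, b]`, where the sum is made along the arc `a₁` that begins at passage `0`. -/
def linkRelators : Set (FreeGroup D.LinkGen) :=
  (FreeGroup.map Sum.inl) '' D.relators ∪
    {FreeGroup.of (Sum.inl (D.arc 0)) * FreeGroup.of (Sum.inr ()) *
      (FreeGroup.of (Sum.inl (D.arc 0)))⁻¹ * (FreeGroup.of (Sum.inr ()))⁻¹}

/-- The group `π₁ K♮` of the link `k ♮ = k ∪ ℓ`, the connected sum of the knot `k` with the Hopf
link, in its Wirtinger presentation. -/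
abbrev LinkGroup : Type := PresentedGroup D.linkRelators

/-- The natural map `π₁ K → π₁ K♮`, which sends every meridian `a_m` to `a_m`. -/
def knotToLink : D.KnotGroup →* D.LinkGroup :=
  PresentedGroup.toGroup (f := fun m => PresentedGroup.of (Sum.inl m)) (by
    intro r hr
    have h : (FreeGroup.lift fun m : D.Arc =>
        (PresentedGroup.of (Sum.inl m) : D.LinkGroup)) =
        (PresentedGroup.mk D.linkRelators).comp (FreeGroup.map Sum.inl) := by
      ext m
      simp [PresentedGroup.of]
    rw [h, MonoidHom.comp_apply]
    exact PresentedGroup.one_of_mem (rels := D.linkRelators) (Or.inl ⟨r, hr, rfl⟩))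

/-- The character of `π₁ K♮` with value `s` on all meridians of `k`, and `t` on that of `ℓ`. -/
def character (s t : ℤˣ) : D.LinkGroup →* ℤˣ :=
  PresentedGroup.toGroup (f := Sum.elim (fun _ => s) (fun _ => t)) (by
    rintro r (⟨r, ⟨p, -, -, rfl⟩, rfl⟩ | rfl)
    · rcases Int.units_eq_one_or s with rfl | rfl <;>
        simp [wirtingerRelator, ← mul_assoc, mul_right_comm]
    · simp [mul_right_comm])

/-- The element `χ_k` of `H¹(K♮; ℤ/2) = Hom(π₁ K♮, {±1})` dual to the meridian of `k`. -/
def chiK : D.LinkGroup →* ℤˣ := D.character (-1) 1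

/-- The element `χ_ℓ` of `H¹(K♮; ℤ/2) = Hom(π₁ K♮, {±1})` dual to the meridian of `ℓ`. -/
def chiL : D.LinkGroup →* ℤˣ := D.character 1 (-1)

end PreDiagram

/-- A diagram of a knot in `S³`: a knot diagram that lives on the sphere.  By Euler's formula
`V - E + F = 2` this means that it has `n + 2` faces, as `V = n` and `E = 2 * n`. -/
structure KnotDiagram extends PreDiagram where
  planar : Nat.card toPreDiagram.Face = n + 2

/-! ### `SU(2)`, `SO(3)` and the adjoint representation -/

abbrev SU2 : Type := Matrix.specialUnitaryGroup (Fin 2) ℂ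

abbrev SO3 : Type := Matrix.specialOrthogonalGroup (Fin 3) ℝ

/-- The inclusion of `ℤ/2 = {±1}` as the center of `SU(2)`. -/
def center : ℤˣ →* SU2 where
  toFun s := ⟨((s : ℤ) : ℂ) • 1, by
    rw [Matrix.mem_specialUnitaryGroup_iff, Matrix.mem_unitaryGroup_iff]
    rcases Int.units_eq_one_or s with rfl | rfl <;>
      simp [Matrix.det_fin_two]⟩
  map_one' := by ext; simp
  map_mul' s t := by ext; simp [mul_assoc, mul_left_comm]

/-- The standard basis `i, j, k` of `su(2)`. -/
def su2Basis : Fin 3 → Matrix (Fin 2) (Fin 2) ℂ :=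
  ![!![Complex.I, 0; 0, -Complex.I], !![0, 1; -1, 0], !![0, Complex.I; Complex.I, 0]]

/-- The element `i` of `SU(2)`. -/
def quatI : SU2 := ⟨su2Basis 0, by
  rw [Matrix.mem_specialUnitaryGroup_iff, Matrix.mem_unitaryGroup_iff]
  constructor
  · ext a b; fin_cases a <;> fin_cases b <;>
      simp [su2Basis, Matrix.mul_apply, Fin.sum_univ_two, Matrix.star_apply]
  · simp [su2Basis, Matrix.det_fin_two]⟩

/-- The element `j` of `SU(2)`. -/
def quatJ : SU2 := ⟨su2Basis 1, by
  rw [Matrix.mem_specialUnitaryGroup_iff, Matrix.mem_unitaryGroup_iff]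
  constructor
  · ext a b; fin_cases a <;> fin_cases b <;>
      simp [su2Basis, Matrix.mul_apply, Fin.sum_univ_two, Matrix.star_apply]
  · simp [su2Basis, Matrix.det_fin_two]⟩

/-- The matrix of the map `x ↦ A * x * Aᴴ` of `su(2)` in the basis `i, j, k`, which is
orthonormal for the inner product `⟨x, y⟩ = -tr (x * y) / 2`. -/
def adMatrix (A : Matrix (Fin 2) (Fin 2) ℂ) : Matrix (Fin 3) (Fin 3) ℝ :=
  Matrix.of fun p q => -(Matrix.trace (su2Basis p * (A * su2Basis q * star A))).re / 2

theorem exists_coords (A : SU2) : ∃ a b c d : ℝ, a ^ 2 + b ^ 2 + c ^ 2 + d ^ 2 = 1 ∧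
    A.1 = !![⟨a, b⟩, ⟨c, d⟩; ⟨-c, d⟩, ⟨a, -b⟩] := by
  obtain ⟨A, hA⟩ := A
  have hdet := (Matrix.mem_specialUnitaryGroup_iff.1 hA).2
  have hu := Matrix.mem_unitaryGroup_iff.1 (Matrix.mem_specialUnitaryGroup_iff.1 hA).1
  have hadj : star A = A.adjugate := by
    have h1 : A.adjugate * A = 1 := by rw [Matrix.adjugate_mul, hdet, one_smul]
    calc star A = (A.adjugate * A) * star A := by rw [h1, one_mul]
      _ = A.adjugate := by rw [mul_assoc, hu, mul_one]
  have h11 : A 1 1 = star (A 0 0) := by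
    have := congrFun (congrFun hadj 0) 0
    simpa [Matrix.adjugate_fin_two, Matrix.star_apply] using this.symm
  have h10 : A 1 0 = -star (A 0 1) := by
    have := congrFun (congrFun hadj 1) 0
    rw [Matrix.adjugate_fin_two] at this
    simp [Matrix.star_apply] at this
    simp [this]
  refine ⟨(A 0 0).re, (A 0 0).im, (A 0 1).re, (A 0 1).im, ?_, ?_⟩
  · have := congrArg Complex.re hdet
    rw [Matrix.det_fin_two, h11, h10] at this
    simp at this
    nlinarith
  · ext i j
    fin_cases i <;> fin_cases j <;> simp [h11, h10] <;> apply Complex.ext <;> simp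

theorem adMatrix_coords (a b c d : ℝ) :
    adMatrix !![⟨a, b⟩, ⟨c, d⟩; ⟨-c, d⟩, ⟨a, -b⟩] =
      !![a ^ 2 + b ^ 2 - c ^ 2 - d ^ 2, 2 * (b * c - a * d), 2 * (b * d + a * c);
        2 * (b * c + a * d), a ^ 2 - b ^ 2 + c ^ 2 - d ^ 2, 2 * (c * d - a * b);
        2 * (b * d - a * c), 2 * (c * d + a * b), a ^ 2 - b ^ 2 - c ^ 2 + d ^ 2] := by
  have hs : star (!![⟨a, b⟩, ⟨c, d⟩; ⟨-c, d⟩, ⟨a, -b⟩] : Matrix (Fin 2) (Fin 2) ℂ) =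
      !![⟨a, -b⟩, ⟨-c, -d⟩; ⟨c, -d⟩, ⟨a, b⟩] := by
    ext i j
    fin_cases i <;> fin_cases j <;> simp [Matrix.star_apply, Complex.ext_iff]
  ext i j
  fin_cases i <;> fin_cases j <;>
    simp [adMatrix, su2Basis, hs, Matrix.trace_fin_two, Matrix.mul_apply,
      Fin.sum_univ_two] <;> ring

theorem adMatrix_mul (A B : SU2) : adMatrix (A * B : SU2).1 = adMatrix A.1 * adMatrix B.1 := by
  obtain ⟨a, b, c, d, -, hA⟩ := exists_coords A
  obtain ⟨a', b', c', d', -, hB⟩ := exists_coords B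
  have hAB : (A * B : SU2).1 =
      !![⟨a * a' - b * b' - c * c' - d * d', a * b' + b * a' + c * d' - d * c'⟩,
        ⟨a * c' - b * d' + c * a' + d * b', a * d' + b * c' - c * b' + d * a'⟩;
        ⟨-(a * c' - b * d' + c * a' + d * b'), a * d' + b * c' - c * b' + d * a'⟩,
        ⟨a * a' - b * b' - c * c' - d * d', -(a * b' + b * a' + c * d' - d * c')⟩] := by
    rw [Submonoid.coe_mul, hA, hB]
    ext i j
    fin_cases i <;> fin_cases j <;>
      simp [Matrix.mul_apply, Fin.sum_univ_two] <;> apply Complex.ext <;> simp <;> ring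
  rw [hAB, hA, hB, adMatrix_coords, adMatrix_coords, adMatrix_coords]
  ext i j
  fin_cases i <;> fin_cases j <;>
    simp [Matrix.mul_apply, Fin.sum_univ_three] <;> ring

theorem adMatrix_mem (A : SU2) :
    adMatrix A.1 ∈ Matrix.specialOrthogonalGroup (Fin 3) ℝ := by
  obtain ⟨a, b, c, d, h, hA⟩ := exists_coords A
  have h2 : (a ^ 2 + b ^ 2 + c ^ 2 + d ^ 2) ^ 2 = 1 := by rw [h, one_pow]
  have h3 : (a ^ 2 + b ^ 2 + c ^ 2 + d ^ 2) ^ 3 = 1 := by rw [h, one_pow]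
  rw [hA, adMatrix_coords, Matrix.mem_specialOrthogonalGroup_iff, Matrix.mem_orthogonalGroup_iff]
  constructor
  · ext i j
    fin_cases i <;> fin_cases j <;>
      simp [Matrix.mul_apply, Fin.sum_univ_three] <;>
      first
        | (rw [← h2]; ring; done)
        | ring
  · rw [Matrix.det_fin_three, ← h3]
    simp
    ring

theorem adMatrix_one : adMatrix 1 = 1 := by
  have h : (1 : Matrix (Fin 2) (Fin 2) ℂ) = !![⟨1, 0⟩, ⟨0, 0⟩; ⟨-0, 0⟩, ⟨1, -0⟩] := by
    ext i j
    fin_cases i <;> fin_cases j <;> simp [Complex.ext_iff]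
  rw [h, adMatrix_coords]
  ext i j
  fin_cases i <;> fin_cases j <;> simp

/-- The adjoint representation `Ad : SU(2) → SO(3)`. -/
def Ad : SU2 →* SO3 where
  toFun A := ⟨adMatrix A.1, adMatrix_mem A⟩
  map_one' := Subtype.ext adMatrix_one
  map_mul' A B := Subtype.ext (adMatrix_mul A B)

theorem center_mul_comm (s : ℤˣ) (A : SU2) : center s * A = A * center s := by
  ext i j
  simp [center]

theorem Ad_center (s : ℤˣ) : Ad (center s) = 1 := by
  apply Subtype.ext
  change adMatrix (((s : ℤ) : ℂ) • 1) = 1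
  rw [← adMatrix_one]
  rcases Int.units_eq_one_or s with rfl | rfl <;> simp [adMatrix]

/-! ### Projective representations -/

section Projective

variable {G : Type} [Group G]

/-- The 2-cocycles on `G` with values in `ℤ/2 = {±1}`. -/
def IsCocycle (c : G → G → ℤˣ) : Prop :=
  ∀ g h k, c (g * h) k * c g h = c g (h * k) * c h k

/-- Two 2-cochains are cohomologous: they differ by a coboundary. -/
def Cohomologous (c c' : G → G → ℤˣ) : Prop :=
  ∃ f : G → ℤˣ, ∀ g h, c' g h = c g h * (f (g * h) * (f h)⁻¹ * (f g)⁻¹)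

/-- `c` is a 2-cocycle whose class in `H²(G; ℤ/2)` is not zero. -/
def IsNontrivialCocycle (c : G → G → ℤˣ) : Prop :=
  IsCocycle c ∧ ¬ Cohomologous (fun _ _ => 1) c

/-- The projective representations `ρ : G → SU(2)` with associated cocycle `c`, with the topology of
pointwise convergence. -/
abbrev ProjRep (c : G → G → ℤˣ) : Type :=
  {ρ : G → SU2 // ∀ g h, ρ (g * h) * (ρ h)⁻¹ * (ρ g)⁻¹ = center (c g h)}

namespace ProjRep

variable {c : G → G → ℤˣ}

theorem map_mul (ρ : ProjRep c) (g h : G) :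
    ρ.1 (g * h) = center (c g h) * (ρ.1 g * ρ.1 h) := by
  rw [← ρ.2 g h]
  group

/-- Conjugation of projective representations by elements of `SU(2)`. -/
abbrev conj (c : G → G → ℤˣ) : Setoid (ProjRep c) where
  r ρ ρ' := ∃ u : SU2, ∀ g, ρ'.1 g = u * ρ.1 g * u⁻¹
  iseqv :=
    { refl := fun ρ => ⟨1, fun g => by simp⟩
      symm := fun {ρ ρ'} ⟨u, hu⟩ => ⟨u⁻¹, fun g => by rw [hu]; group⟩
      trans := fun {ρ ρ' ρ''} ⟨u, hu⟩ ⟨v, hv⟩ => ⟨v * u, fun g => by rw [hv, hu]; group⟩ }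

/-- The product `χ · ρ` with a character `χ : G → {±1}`. -/
def twist (χ : G →* ℤˣ) (ρ : ProjRep c) : ProjRep c :=
  ⟨fun g => center (χ g) * ρ.1 g, fun g h => by
    have e : center (χ (g * h)) = center (χ g) * center (χ h) := by simp
    have k := ρ.map_mul g h
    calc center (χ (g * h)) * ρ.1 (g * h) * (center (χ h) * ρ.1 h)⁻¹ * (center (χ g) * ρ.1 g)⁻¹
        = center (χ g) * (center (χ h) * center (c g h)) * ρ.1 g *
            (center (χ h))⁻¹ * (center (χ g) * ρ.1 g)⁻¹ := by rw [e, k]; group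
      _ = center (χ g) * (center (c g h) * center (χ h)) * ρ.1 g *
            (center (χ h))⁻¹ * (center (χ g) * ρ.1 g)⁻¹ := by
          rw [center_mul_comm (χ h) (center (c g h))]
      _ = center (χ g) * center (c g h) * (center (χ h) * ρ.1 g) *
            (center (χ h))⁻¹ * (center (χ g) * ρ.1 g)⁻¹ := by group
      _ = center (χ g) * center (c g h) * (center (χ g))⁻¹ := by
          rw [center_mul_comm (χ h) (ρ.1 g)]; group
      _ = center (c g h) := by rw [center_mul_comm (χ g)]; group⟩

/-- The adjoint `Ad ρ : G → SO(3)` of a projective representation. -/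
def adjoint (ρ : ProjRep c) : G →* SO3 :=
  MonoidHom.mk' (fun g => Ad (ρ.1 g)) (fun g h => by
    rw [ρ.map_mul, _root_.map_mul, Ad_center, one_mul, _root_.map_mul])

end ProjRep

/-- The space `PR_c(G; SU(2))` of conjugacy classes of projective representations with
cocycle `c`. -/
abbrev PR (c : G → G → ℤˣ) : Type := Quotient (ProjRep.conj c)

/-- The action of `H¹(G; ℤ/2) = Hom(G, {±1})` on `PR_c(G; SU(2))`, by `χ · [ρ] = [χ · ρ]`. -/
instance (c : G → G → ℤˣ) : MulAction (G →* ℤˣ) (PR c) where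
  smul χ := Quotient.map (ProjRep.twist χ) (by
    rintro ρ ρ' ⟨u, hu⟩
    refine ⟨u, fun g => ?_⟩
    simp only [ProjRep.twist, hu]
    rw [← mul_assoc, ← mul_assoc, center_mul_comm, mul_assoc u])
  one_smul := by
    rintro ⟨ρ⟩
    refine congrArg (Quotient.mk _) (Subtype.ext (funext fun g => ?_))
    simp [ProjRep.twist]
  mul_smul χ χ' := by
    rintro ⟨ρ⟩
    refine congrArg (Quotient.mk _) (Subtype.ext (funext fun g => ?_))
    simp [ProjRep.twist, mul_assoc]

/-- Conjugation of representations in `SO(3)`. -/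
abbrev conjSO3 (G : Type) [Group G] : Setoid (G →* SO3) where
  r ρ ρ' := ∃ u : SO3, ∀ g, ρ' g = u * ρ g * u⁻¹
  iseqv :=
    { refl := fun ρ => ⟨1, fun g => by simp⟩
      symm := fun {ρ ρ'} ⟨u, hu⟩ => ⟨u⁻¹, fun g => by rw [hu]; group⟩
      trans := fun {ρ ρ' ρ''} ⟨u, hu⟩ ⟨v, hv⟩ => ⟨v * u, fun g => by rw [hv, hu]; group⟩ }

/-- A representation in `SO(3)` is reducible if its image lies in a copy of `SO(2)`: it is conjugate
to a representation by matrices of the form `(A, 1)` with `A` in `SO(2)`. -/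
def IsReducible (ρ : G →* SO3) : Prop :=
  ∃ u : SO3, ∀ g, ∃ A ∈ Matrix.specialOrthogonalGroup (Fin 2) ℝ,
    (u * ρ g * u⁻¹).1 = !![A 0 0, A 0 1, 0; A 1 0, A 1 1, 0; 0, 0, 1]

/-- A representation in `SO(3)` is dihedral if it factors through a copy of `O(2)`: it is conjugate
to a representation by matrices of the form `(A, det A)` with `A` in `O(2)`. -/
def IsDihedral (ρ : G →* SO3) : Prop :=
  ∃ u : SO3, ∀ g, ∃ A ∈ Matrix.orthogonalGroup (Fin 2) ℝ,
    (u * ρ g * u⁻¹).1 = !![A 0 0, A 0 1, 0; A 1 0, A 1 1, 0; 0, 0, A.det]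

end Projective

namespace PreDiagram

variable (D : PreDiagram)

/-- A representation of the knot group in `SO(3)` is traceless (lifts to traceless matrices
in `SU(2)`) if it sends the meridians to matrices of trace `-1`. -/
def IsTraceless (ρ : D.KnotGroup →* SO3) : Prop :=
  ∀ m : D.Arc, Matrix.trace (ρ (PresentedGroup.of m)).1 = -1

/-- The set `R₀(K, SO(3))` of conjugacy classes of traceless representations, inside the set of
conjugacy classes of all representations. -/
def R0 : Set (Quotient (conjSO3 D.KnotGroup)) :=
  {x | ∃ ρ, D.IsTraceless ρ ∧ Quotient.mk _ ρ = x}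

/-- The map `ψ`, which sends `[ρ]` to the class of the restriction of `Ad ρ` to the knot group. -/
def psi (c : D.LinkGroup → D.LinkGroup → ℤˣ) : PR c → Quotient (conjSO3 D.KnotGroup) :=
  Quotient.map (fun ρ => ρ.adjoint.comp D.knotToLink) (by
    rintro ρ ρ' ⟨u, hu⟩
    refine ⟨Ad u, fun g => ?_⟩
    simp [ProjRep.adjoint, hu])

/-- The projective representation `ρ` is `α = (i, …, i; j)`, in terms of the free group on the
meridians: it agrees up to signs with the homomorphism that sends the meridians of `k` to `i` and
the meridian of `ℓ` to `j`. -/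
def IsAlpha {c : D.LinkGroup → D.LinkGroup → ℤˣ} (ρ : ProjRep c) : Prop :=
  ∀ w : FreeGroup D.LinkGen, ∃ s : ℤˣ, ρ.1 (PresentedGroup.mk D.linkRelators w) =
    center s * FreeGroup.lift (Sum.elim (fun _ => quatI) (fun _ => quatJ)) w

end PreDiagram

end KnotHopf

end

/-!
The argument rests on the fact that one can travel along the knot from the first meridian to
every other one without using the omitted Wirtinger relator (`edge_induction`, `arc_induction`).
At each lower passage the relator expresses the next meridian as a conjugate of the previous
one. So all meridians are conjugate, which gives the characters of the group, and
representations of the knot group lift through central extensions (`exists_lift`): in the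
relator, the lift of the upper arc matters only up to central factors.

For the second cohomology, consider the central extension by `±1` that belongs to a cocycle `c`.
By the lifting property it splits over the knot group, so that the only obstruction to a
splitting over the link group is the commutator of lifts of the commuting meridians `a₁` and
`b`, which is the sign `c(a₁, b) c(b, a₁)`. This sign is multiplicative in `c`, so there is at
most one nontrivial class (`cohomologous_of_nontrivial`); pulling back `SU(2) → SO(3)` along the
representation that sends the meridians to `Ad i` and `b` to `Ad j` gives one.

For a nontrivial `c`, a projective representation `α` that agrees with `(i, …, i; j)` up to
signs exists, and its signs turn any pair `(A, B)`, where `A` is a representation of the knot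
group in `SU(2)` and `B` anticommutes with `A(a₁)`, into a projective representation `rep` with
cocycle `c`. All of them arise in this way (`exists_eq_rep`); conjugation, characters and `ψ`
are easily expressed in terms of `(A, B)`.

Now fix a traceless representation of the knot group in `SO(3)`. It has exactly two lifts `± A`
to `SU(2)`, and the elements that anticommute with the purely imaginary quaternion `P = A(a₁)`
form a circle, the coset `{x + y P} B` of the centralizer of `P`. So the fiber of `ψ` is the
quotient of two circles (`fiberPoint`) by the centralizer of the given representation. If this
is irreducible and not dihedral, then the centralizer is trivial; if it is irreducible and
dihedral, then the only other element is the half turn around the axis of the dihedral group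
(`exists_anti_of_isDihedral`), which identifies the two circles by `z ↦ z⁻¹`; and if it is
reducible, then all meridians have the same image, and the centralizer acts transitively.
Continuous bijections from compact spaces onto the fibers are homeomorphisms because the space
of conjugacy classes is Hausdorff, `SU(2)` being compact.
-/

noncomputable section

namespace KnotHopf

/-! ### Homomorphisms out of the knot group -/

namespace PreDiagram

variable (D : PreDiagram)

instance : NeZero (2 * D.n) := ⟨by have := D.n_pos; omega⟩

theorem val_eq_val_sub_one_add_one {p : ZMod (2 * D.n)} (hp : p ≠ 0) :
    p.val = (p - 1).val + 1 := by
  have h1 : 1 < 2 * D.n := by have := D.n_pos; omega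
  have : Fact (1 < 2 * D.n) := ⟨h1⟩
  have hv : 1 ≤ p.val := Nat.one_le_iff_ne_zero.2 ((ZMod.val_eq_zero p).not.2 hp)
  have : (p - 1).val = p.val - (1 : ZMod (2 * D.n)).val :=
    ZMod.val_sub (by rw [ZMod.val_one]; exact hv)
  rw [this, ZMod.val_one]
  omega

/-- Induction along the knot, starting with the edge `0` and never crossing passage `0`. -/
theorem edge_induction {P : ZMod (2 * D.n) → Prop} (h0 : P 0)
    (hs : ∀ p, p ≠ 0 → P (p - 1) → P p) (p : ZMod (2 * D.n)) : P p := by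
  induction hk : p.val generalizing p with
  | zero => rwa [(ZMod.val_eq_zero p).1 hk]
  | succ k ih =>
    have hp : p ≠ 0 := by rintro rfl; simp at hk
    refine hs p hp (ih _ ?_)
    have := D.val_eq_val_sub_one_add_one hp
    omega

/-- Recursion along the knot, starting with the edge `0` and never crossing passage `0`. -/
theorem exists_edge_recursion {E : Type*} (x : E) (step : ZMod (2 * D.n) → E → E) :
    ∃ F : ZMod (2 * D.n) → E, F 0 = x ∧ ∀ p, p ≠ 0 → F p = step p (F (p - 1)) := by
  refine ⟨fun p => Nat.rec x (fun k y => step ((k + 1 : ℕ) : ZMod (2 * D.n)) y) p.val, ?_, ?_⟩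
  · simp
  · intro p hp
    have h := D.val_eq_val_sub_one_add_one hp
    simp only
    rw [h]
    simp only
    rw [← h, ZMod.natCast_zmod_val]

theorem arc_eq_of_isOver {p : ZMod (2 * D.n)} (hp : D.isOver p = true) :
    D.arc p = D.arc (p - 1) := by
  refine (Quot.sound ?_).symm
  exact ⟨by ring, hp⟩

/-- The meridian of an arc, as an element of the knot group. -/
abbrev meridian (m : D.Arc) : D.KnotGroup := PresentedGroup.of m

/-- The meridian of the knot, as an element of the link group. -/
abbrev linkMeridian (m : D.Arc) : D.LinkGroup := PresentedGroup.of (Sum.inl m)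

/-- The meridian of the second component `ℓ`. -/
abbrev hopfMeridian : D.LinkGroup := PresentedGroup.of (Sum.inr ())

@[simp]
theorem knotToLink_meridian (m : D.Arc) : D.knotToLink (D.meridian m) = D.linkMeridian m :=
  PresentedGroup.toGroup.of _

theorem meridian_eq_conj {p : ZMod (2 * D.n)} (hp : p ≠ 0) (ho : D.isOver p = false) :
    D.meridian (D.arc p) = D.meridian (D.arc (D.mate p)) ^ (D.sign p : ℤ) *
      D.meridian (D.arc (p - 1)) * (D.meridian (D.arc (D.mate p)) ^ (D.sign p : ℤ))⁻¹ := by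
  have h := PresentedGroup.one_of_mem (rels := D.relators) ⟨p, hp, ho, rfl⟩
  rw [wirtingerRelator] at h
  simp only [map_mul, map_zpow, map_inv] at h
  rw [mul_inv_eq_one] at h
  rw [← zpow_neg]
  exact h.symm

/-- Induction over the arcs of the knot: as one passes under an arc `o`, the meridian is
conjugated by the meridian of `o` or its inverse. -/
theorem arc_induction {P : D.Arc → Prop} (h0 : P (D.arc 0))
    (hs : ∀ (m m' o : D.Arc) (k : ℤ), D.meridian m' = D.meridian o ^ k * D.meridian m *
      (D.meridian o ^ k)⁻¹ → P m → P m') (m : D.Arc) : P m := by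
  obtain ⟨p, rfl⟩ := Quot.exists_rep m
  change P (D.arc p)
  refine D.edge_induction (P := fun p => P (D.arc p)) h0 (fun p hp h => ?_) p
  cases ho : D.isOver p with
  | true => rwa [D.arc_eq_of_isOver ho]
  | false => exact hs _ _ _ _ (D.meridian_eq_conj hp ho) h

/-- Homomorphisms out of the knot group, from values on the edges that are compatible with the
crossings. -/
theorem exists_hom_of_edges {E : Type*} [Group E] (F : ZMod (2 * D.n) → E)
    (hover : ∀ p, D.isOver p = true → F p = F (p - 1))
    (hunder : ∀ p, p ≠ 0 → D.isOver p = false →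
      F p = F (D.mate p) ^ (D.sign p : ℤ) * F (p - 1) * (F (D.mate p) ^ (D.sign p : ℤ))⁻¹) :
    ∃ φ : D.KnotGroup →* E, ∀ p, φ (D.meridian (D.arc p)) = F p := by
  let f : D.Arc → E := Quot.lift F (by
    rintro e e' ⟨rfl, ho⟩
    rw [hover _ ho, add_sub_cancel_right])
  refine ⟨PresentedGroup.toGroup (f := f) ?_, fun p => PresentedGroup.toGroup.of _⟩
  rintro r ⟨p, hp, ho, rfl⟩
  simp only [wirtingerRelator, map_mul, map_zpow, map_inv, FreeGroup.lift_apply_of]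
  rw [mul_inv_eq_one, zpow_neg]
  exact (hunder p hp ho).symm

/-- A homomorphism out of the knot group lifts through a homomorphism with central kernel, provided
that the meridians lift, and the lift of the first meridian can be prescribed.  The lifts of
the other meridians are found one after the other along the knot: the relator at a lower passage
determines the lift on the outgoing arc, and does not depend on the choice of the lift on
the upper arc because the kernel is central. -/
theorem exists_lift {E H : Type*} [Group E] [Group H] (π : E →* H)
    (hπ : ∀ x, π x = 1 → ∀ y, x * y = y * x) (φ : D.KnotGroup →* H)
    (hφ : ∀ m, ∃ x, π x = φ (D.meridian m)) (x₀ : E) (hx₀ : π x₀ = φ (D.meridian (D.arc 0))) :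
    ∃ φ' : D.KnotGroup →* E, π.comp φ' = φ ∧ φ' (D.meridian (D.arc 0)) = x₀ := by
  choose q hq using hφ
  obtain ⟨F, hF0, hF⟩ := D.exists_edge_recursion x₀ (fun p y =>
    if D.isOver p = true then y else
      q (D.arc (D.mate p)) ^ (D.sign p : ℤ) * y * (q (D.arc (D.mate p)) ^ (D.sign p : ℤ))⁻¹)
  have hover : ∀ p, D.isOver p = true → F p = F (p - 1) := by
    intro p ho
    have hp : p ≠ 0 := by
      rintro rfl
      simp [D.isOver_zero] at ho
    simpa [ho] using hF p hp
  have hunder : ∀ p, p ≠ 0 → D.isOver p = false → F p = q (D.arc (D.mate p)) ^ (D.sign p : ℤ) *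
      F (p - 1) * (q (D.arc (D.mate p)) ^ (D.sign p : ℤ))⁻¹ := by
    intro p hp ho
    simpa [ho] using hF p hp
  have hπF : ∀ p, π (F p) = φ (D.meridian (D.arc p)) := by
    refine D.edge_induction (by rw [hF0, hx₀]) (fun p hp h => ?_)
    cases ho : D.isOver p with
    | true => rw [hover p ho, h, D.arc_eq_of_isOver ho]
    | false =>
      rw [hunder p hp ho, D.meridian_eq_conj hp ho]
      simp [h, hq]
  have hconj : ∀ (x y z : E) (k : ℤ), π x = π y →
      x ^ k * z * (x ^ k)⁻¹ = y ^ k * z * (y ^ k)⁻¹ := by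
    intro x y z k hxy
    have h := hπ ((y ^ k)⁻¹ * x ^ k) (by simp [hxy]) z
    calc x ^ k * z * (x ^ k)⁻¹ = y ^ k * ((y ^ k)⁻¹ * x ^ k * z) * (x ^ k)⁻¹ := by group
      _ = _ := by rw [h]; group
  obtain ⟨φ', hφ'⟩ := D.exists_hom_of_edges F hover (fun p hp ho => by
    rw [hunder p hp ho]
    exact hconj _ _ _ _ (by rw [hq, hπF]))
  refine ⟨φ', PresentedGroup.ext fun m => ?_, by rw [hφ', hF0]⟩
  obtain ⟨p, rfl⟩ := Quot.exists_rep m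
  exact (congrArg π (hφ' p)).trans (hπF p)

/-- The homomorphism that sends all meridians to the same element. -/
def constHom {E : Type*} [Group E] (x : E) : D.KnotGroup →* E :=
  PresentedGroup.toGroup (f := fun _ => x) (by
    rintro r ⟨p, -, -, rfl⟩
    simp only [wirtingerRelator, map_mul, map_zpow, map_inv, FreeGroup.lift_apply_of]
    group)

@[simp]
theorem constHom_meridian {E : Type*} [Group E] (x : E) (m : D.Arc) :
    D.constHom x (D.meridian m) = x :=
  PresentedGroup.toGroup.of _

variable {D}

theorem eq_constHom_of_commute {E : Type*} [Group E] {φ : D.KnotGroup →* E}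
    (h : ∀ m m', Commute (φ (D.meridian m)) (φ (D.meridian m'))) :
    φ = D.constHom (φ (D.meridian (D.arc 0))) := by
  refine PresentedGroup.ext fun m => ?_
  refine (D.arc_induction (P := fun m => φ (D.meridian m) = φ (D.meridian (D.arc 0)))
    rfl ?_ m).trans (D.constHom_meridian _ m).symm
  intro m m' o k hm' hm
  rw [hm', map_mul, map_mul, map_inv, map_zpow, ((h o m).zpow_left k).eq, mul_inv_cancel_right, hm]

theorem isConj_meridian {E : Type*} [Group E] (φ : D.KnotGroup →* E) (m : D.Arc) :
    IsConj (φ (D.meridian (D.arc 0))) (φ (D.meridian m)) := by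
  refine D.arc_induction (P := fun m => IsConj (φ (D.meridian (D.arc 0))) (φ (D.meridian m)))
    (IsConj.refl _) (fun m m' o k hm' hm => hm.trans ?_) m
  rw [hm', map_mul, map_mul, map_inv]
  exact isConj_iff.2 ⟨_, rfl⟩

/-- Two homomorphisms that agree up to central factors on all meridians agree up to
a single central factor. -/
theorem eq_mul_of_central {E : Type*} [Group E] {φ φ' : D.KnotGroup →* E}
    (h : ∀ m, ∃ z ∈ Subgroup.center E, φ' (D.meridian m) = z * φ (D.meridian m)) :
    ∃ z ∈ Subgroup.center E, ∀ m, φ' (D.meridian m) = z * φ (D.meridian m) := by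
  obtain ⟨z, hz, h0⟩ := h (D.arc 0)
  refine ⟨z, hz, D.arc_induction h0 fun m m' o k hm' hm => ?_⟩
  obtain ⟨w, hw, ho⟩ := h o
  have hwk := Subgroup.zpow_mem _ hw k
  rw [Subgroup.mem_center_iff] at hz hwk
  have hc : Commute w (φ (D.meridian o)) := ((Subgroup.mem_center_iff.1 hw) _).symm
  rw [hm', map_mul, map_mul, map_inv, map_zpow, map_mul, map_mul, map_inv, map_zpow, ho, hm,
    hc.mul_zpow]
  calc w ^ k * φ (D.meridian o) ^ k * (z * φ (D.meridian m)) * (w ^ k * φ (D.meridian o) ^ k)⁻¹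
      = (w ^ k * (φ (D.meridian o) ^ k * z * φ (D.meridian m) * (φ (D.meridian o) ^ k)⁻¹)) *
          (w ^ k)⁻¹ := by group
    _ = φ (D.meridian o) ^ k * z * φ (D.meridian m) * (φ (D.meridian o) ^ k)⁻¹ := by
        rw [← hwk]; group
    _ = z * (φ (D.meridian o) ^ k * φ (D.meridian m) * (φ (D.meridian o) ^ k)⁻¹) := by
        rw [hz]; group

/-! ### Homomorphisms out of the link group, and the first cohomology -/

theorem linkMeridian_commute_hopfMeridian :
    Commute (D.linkMeridian (D.arc 0)) D.hopfMeridian := by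
  have h := PresentedGroup.one_of_mem (rels := D.linkRelators) (Or.inr rfl)
  simp only [map_mul, map_inv] at h
  exact mul_inv_eq_iff_eq_mul.1 (mul_inv_eq_one.1 h)

/-- A homomorphism out of the knot group extends to the link group, with any value on the meridian
of the second component that commutes with the value on the first meridian. -/
theorem exists_linkHom {E : Type*} [Group E] (φ : D.KnotGroup →* E) (y : E)
    (h : Commute (φ (D.meridian (D.arc 0))) y) :
    ∃ Φ : D.LinkGroup →* E, Φ.comp D.knotToLink = φ ∧ Φ D.hopfMeridian = y := by
  refine ⟨PresentedGroup.toGroup (f := Sum.elim (fun m => φ (D.meridian m)) (fun _ => y)) ?_,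
    PresentedGroup.ext fun m => ?_, PresentedGroup.toGroup.of _⟩
  · rintro r (⟨r, hr, rfl⟩ | rfl)
    · have e : (FreeGroup.lift (Sum.elim (fun m => φ (D.meridian m)) (fun _ : Unit => y))).comp
          (FreeGroup.map Sum.inl) = φ.comp (PresentedGroup.mk D.relators) := by
        ext m
        simp [PresentedGroup.of]
      have := DFunLike.congr_fun e r
      simp only [MonoidHom.comp_apply] at this
      rw [this, PresentedGroup.one_of_mem hr, map_one]
    · simp [h.eq]
  · rw [MonoidHom.comp_apply]
    exact (congrArg _ (D.knotToLink_meridian m)).trans (PresentedGroup.toGroup.of _)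

theorem linkHom_ext {E : Type*} [Group E] {Φ Φ' : D.LinkGroup →* E}
    (h : Φ.comp D.knotToLink = Φ'.comp D.knotToLink) (h' : Φ D.hopfMeridian = Φ' D.hopfMeridian) :
    Φ = Φ' := by
  refine PresentedGroup.ext fun x => ?_
  rcases x with m | ⟨⟩
  · have := DFunLike.congr_fun h (D.meridian m)
    simpa using this
  · exact h'

@[simp]
theorem character_linkMeridian (s t : ℤˣ) (m : D.Arc) : D.character s t (D.linkMeridian m) = s :=
  PresentedGroup.toGroup.of _

@[simp]
theorem character_hopfMeridian (s t : ℤˣ) : D.character s t D.hopfMeridian = t :=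
  PresentedGroup.toGroup.of _

theorem eq_character (χ : D.LinkGroup →* ℤˣ) :
    χ = D.character (χ (D.linkMeridian (D.arc 0))) (χ D.hopfMeridian) := by
  refine linkHom_ext ?_ (by simp)
  rw [eq_constHom_of_commute (φ := χ.comp D.knotToLink) fun _ _ => Commute.all _ _]
  refine PresentedGroup.ext fun m => ?_
  rw [MonoidHom.comp_apply]
  change D.constHom _ (D.meridian m) = D.character _ _ (D.knotToLink (D.meridian m))
  simp

variable (D) in
/-- A character is determined by its values on the two meridians. -/
def characterEquiv : (D.LinkGroup →* ℤˣ) ≃* ℤˣ × ℤˣ where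
  toFun χ := (χ (D.linkMeridian (D.arc 0)), χ D.hopfMeridian)
  invFun x := D.character x.1 x.2
  left_inv χ := (eq_character χ).symm
  right_inv x := by simp
  map_mul' χ χ' := rfl

end PreDiagram

/-! ### Unit quaternions -/

/-- The quaternion `a + b i + c j + d k` as a matrix. -/
def quat (a b c d : ℝ) : Matrix (Fin 2) (Fin 2) ℂ := !![⟨a, b⟩, ⟨c, d⟩; ⟨-c, d⟩, ⟨a, -b⟩]

theorem quat_inj {a b c d a' b' c' d' : ℝ} :
    quat a b c d = quat a' b' c' d' ↔ a = a' ∧ b = b' ∧ c = c' ∧ d = d' := by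
  constructor
  · intro h
    have h0 := congrFun (congrFun h 0) 0
    have h1 := congrFun (congrFun h 0) 1
    simp only [quat, Matrix.of_apply, Matrix.cons_val', Matrix.cons_val_zero,
      Matrix.cons_val_one, Complex.mk.injEq] at h0 h1
    exact ⟨h0.1, h0.2, h1.1, h1.2⟩
  · rintro ⟨rfl, rfl, rfl, rfl⟩
    rfl

theorem quat_mul (a b c d a' b' c' d' : ℝ) :
    quat a b c d * quat a' b' c' d' =
      quat (a * a' - b * b' - c * c' - d * d') (a * b' + b * a' + c * d' - d * c')
        (a * c' - b * d' + c * a' + d * b') (a * d' + b * c' - c * b' + d * a') := by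
  ext i j
  fin_cases i <;> fin_cases j <;>
    simp [quat, Matrix.mul_apply, Fin.sum_univ_two] <;> apply Complex.ext <;> simp <;> ring

theorem star_quat (a b c d : ℝ) : star (quat a b c d) = quat a (-b) (-c) (-d) := by
  ext i j
  fin_cases i <;> fin_cases j <;> simp [quat, Matrix.star_apply, Complex.ext_iff]

theorem one_eq_quat : (1 : Matrix (Fin 2) (Fin 2) ℂ) = quat 1 0 0 0 := by
  ext i j
  fin_cases i <;> fin_cases j <;> simp [quat, Complex.ext_iff]

theorem quat_mem {a b c d : ℝ} (h : a ^ 2 + b ^ 2 + c ^ 2 + d ^ 2 = 1) :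
    quat a b c d ∈ Matrix.specialUnitaryGroup (Fin 2) ℂ := by
  rw [Matrix.mem_specialUnitaryGroup_iff, Matrix.mem_unitaryGroup_iff]
  constructor
  · rw [star_quat, quat_mul, one_eq_quat, quat_inj]
    refine ⟨by linarith, by ring, by ring, by ring⟩
  · rw [quat, Matrix.det_fin_two]
    apply Complex.ext
    · simp
      linarith
    · simp
      ring

theorem exists_quat (A : SU2) :
    ∃ a b c d : ℝ, a ^ 2 + b ^ 2 + c ^ 2 + d ^ 2 = 1 ∧ A.1 = quat a b c d :=
  exists_coords A

theorem smul_add_smul_quat (x y a b c d : ℝ) :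
    (x : ℂ) • (1 : Matrix (Fin 2) (Fin 2) ℂ) + (y : ℂ) • quat a b c d =
      quat (x + y * a) (y * b) (y * c) (y * d) := by
  ext i j
  fin_cases i <;> fin_cases j <;> simp [quat, Complex.ext_iff]

theorem center_coe (s : ℤˣ) : (center s).1 = quat (s : ℤ) 0 0 0 := by
  have := smul_add_smul_quat (s : ℤ) 0 1 0 0 0
  simp only [Complex.ofReal_zero, zero_smul, add_zero, zero_mul] at this
  rw [← this]
  simp [center]

theorem center_injective : Function.Injective center := by
  intro s t h
  have := congrArg Subtype.val h
  rw [center_coe, center_coe, quat_inj] at this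
  exact Units.ext (by exact_mod_cast this.1)

theorem center_mem_center (s : ℤˣ) : center s ∈ Subgroup.center SU2 :=
  Subgroup.mem_center_iff.2 fun A => (center_mul_comm s A).symm

theorem center_mul_self (s : ℤˣ) : center s * center s = 1 := by
  rw [← map_mul, Int.units_mul_self, map_one]

@[simp]
theorem center_inv (s : ℤˣ) : (center s)⁻¹ = center s :=
  inv_eq_of_mul_eq_one_left (center_mul_self s)

theorem center_neg_one_ne_one : center (-1) ≠ 1 := by
  rw [← map_one center]
  exact fun h => absurd (center_injective h) (by decide)

theorem exists_center_of_eq {A : SU2} {x : ℝ} (h : A.1 = quat x 0 0 0) : ∃ s, A = center s := by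
  obtain ⟨a, b, c, d, h1, hA⟩ := exists_quat A
  obtain ⟨rfl, rfl, rfl, rfl⟩ := quat_inj.1 (hA.symm.trans h)
  rcases mul_self_eq_one_iff.1 (by linarith : a * a = 1) with rfl | rfl
  · exact ⟨1, Subtype.ext (by rw [h, center_coe]; simp)⟩
  · exact ⟨-1, Subtype.ext (by rw [h, center_coe]; simp)⟩

/-- The only square roots of `1` in `SU(2)` are `±1`. -/
theorem exists_center_of_mul_self {A : SU2} (h : A * A = 1) : ∃ s, A = center s := by
  obtain ⟨a, b, c, d, h1, hA⟩ := exists_quat A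
  have h2 : A.1 * A.1 = 1 := congrArg Subtype.val h
  rw [hA, quat_mul, one_eq_quat, quat_inj] at h2
  obtain ⟨h2, -⟩ := h2
  have hb : b = 0 := by nlinarith
  have hc : c = 0 := by nlinarith
  have hd : d = 0 := by nlinarith
  subst hb hc hd
  exact exists_center_of_eq hA

/-- A unit quaternion is purely imaginary if its square is `-1`. -/
def IsImaginary (P : SU2) : Prop := P * P = center (-1)

theorem isImaginary_iff {P : SU2} {a b c d : ℝ} (hP : P.1 = quat a b c d) :
    IsImaginary P ↔ a = 0 := by
  obtain ⟨a', b', c', d', h1, hP'⟩ := exists_quat P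
  obtain ⟨rfl, rfl, rfl, rfl⟩ := quat_inj.1 (hP.symm.trans hP')
  rw [IsImaginary, Subtype.ext_iff, Submonoid.coe_mul, hP, quat_mul, center_coe, quat_inj]
  constructor
  · rintro ⟨h, -⟩
    push_cast at h
    nlinarith
  · rintro rfl
    push_cast
    refine ⟨by linarith, by ring, by ring, by ring⟩

theorem IsImaginary.exists_quat {P : SU2} (hP : IsImaginary P) :
    ∃ b c d : ℝ, b ^ 2 + c ^ 2 + d ^ 2 = 1 ∧ P.1 = quat 0 b c d := by
  obtain ⟨a, b, c, d, h, hA⟩ := KnotHopf.exists_quat P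
  obtain rfl := (isImaginary_iff hA).1 hP
  exact ⟨b, c, d, by linarith, hA⟩

theorem IsImaginary.conj {P : SU2} (hP : IsImaginary P) (u : SU2) :
    IsImaginary (u * P * u⁻¹) := by
  unfold IsImaginary at *
  calc u * P * u⁻¹ * (u * P * u⁻¹) = u * (P * P) * u⁻¹ := by group
    _ = center (-1) := by rw [hP, ← center_mul_comm]; group

theorem IsImaginary.inv {P : SU2} (hP : IsImaginary P) : P⁻¹ = center (-1) * P := by
  rw [inv_eq_iff_mul_eq_one, center_mul_comm, ← mul_assoc, hP, center_mul_self]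

/-- Two commuting purely imaginary unit quaternions agree up to sign. -/
theorem IsImaginary.eq_of_commute {P Q : SU2} (hP : IsImaginary P) (hQ : IsImaginary Q)
    (h : Commute P Q) : ∃ s, Q = center s * P := by
  obtain ⟨s, hs⟩ := exists_center_of_mul_self (A := Q * P) (by
    calc Q * P * (Q * P) = Q * (P * Q) * P := by group
      _ = (Q * Q) * (P * P) := by rw [h.eq]; group
      _ = 1 := by rw [hP, hQ, center_mul_self])
  refine ⟨s * -1, ?_⟩
  rw [eq_mul_inv_of_mul_eq hs, hP.inv, map_mul, mul_assoc]

/-- `P` and `B` anticommute: `P * B = - B * P`. -/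
def Anti (P B : SU2) : Prop := P * B = center (-1) * (B * P)

theorem Anti.symm {P B : SU2} (h : Anti P B) : Anti B P := by
  unfold Anti at *
  rw [h, ← mul_assoc, center_mul_self, one_mul]

theorem Anti.conj {P B : SU2} (h : Anti P B) (u : SU2) : Anti (u * P * u⁻¹) (u * B * u⁻¹) := by
  unfold Anti at *
  calc u * P * u⁻¹ * (u * B * u⁻¹) = u * (P * B) * u⁻¹ := by group
    _ = (u * center (-1)) * B * P * u⁻¹ := by rw [h]; group
    _ = _ := by rw [← center_mul_comm]; group

theorem Anti.center_mul {P B : SU2} (h : Anti P B) (s t : ℤˣ) :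
    Anti (center s * P) (center t * B) := by
  unfold Anti at *
  calc center s * P * (center t * B) = center s * (P * center t) * B := by group
    _ = (center s * center t) * (P * B) := by rw [← center_mul_comm]; group
    _ = ((center s * center t) * center (-1)) * (B * P) := by rw [h]; group
    _ = (center (-1) * (center s * center t)) * (B * P) := by
        rw [← map_mul, center_mul_comm]
    _ = center (-1) * (center t * (center s * B) * P) := by
        rw [← map_mul, mul_comm s, map_mul]; group
    _ = center (-1) * (center t * B * (center s * P)) := by rw [center_mul_comm s B]; group

theorem Anti.conj_eq {P B : SU2} (h : Anti P B) : B * P * B⁻¹ = center (-1) * P := by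
  rw [h.symm, mul_assoc, mul_assoc, mul_inv_cancel, mul_one]

theorem anti_of_conj_eq {P B : SU2} (h : B * P * B⁻¹ = center (-1) * P) : Anti P B := by
  refine Anti.symm ?_
  rw [Anti, mul_inv_eq_iff_eq_mul.1 h, mul_assoc]

/-- If `P` and `B` anticommute, then `P` is conjugate to `-P`, so that its real part vanishes. -/
theorem Anti.isImaginary_left {P B : SU2} (h : Anti P B) : IsImaginary P := by
  obtain ⟨a, b, c, d, h1, hP⟩ := exists_quat P
  obtain ⟨a', b', c', d', h1', hB⟩ := exists_quat B
  have h2 := congrArg Subtype.val h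
  simp only [Submonoid.coe_mul, center_coe] at h2
  rw [hP, hB, quat_mul, quat_mul, quat_mul, quat_inj] at h2
  push_cast at h2
  obtain ⟨h2, h3, h4, h5⟩ := h2
  rw [isImaginary_iff hP]
  have e : a = a * (a' ^ 2 + b' ^ 2 + c' ^ 2 + d' ^ 2) := by rw [h1', mul_one]
  rw [e]
  linear_combination a' / 2 * h2 + b' / 2 * h3 + c' / 2 * h4 + d' / 2 * h5

theorem Anti.isImaginary_right {P B : SU2} (h : Anti P B) : IsImaginary B :=
  h.symm.isImaginary_left

theorem quatI_coe : quatI.1 = quat 0 1 0 0 := by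
  ext i j
  fin_cases i <;> fin_cases j <;> simp [quatI, su2Basis, quat, Complex.ext_iff]

theorem quatJ_coe : quatJ.1 = quat 0 0 1 0 := by
  ext i j
  fin_cases i <;> fin_cases j <;> simp [quatJ, su2Basis, quat, Complex.ext_iff]

/-- The element `k` of `SU(2)`. -/
def quatK : SU2 := ⟨quat 0 0 0 1, quat_mem (by norm_num)⟩

theorem anti_quatI_quatJ : Anti quatI quatJ := by
  apply Subtype.ext
  simp only [Submonoid.coe_mul, center_coe, quatI_coe, quatJ_coe, quat_mul]
  norm_num

theorem isImaginary_quatI : IsImaginary quatI := anti_quatI_quatJ.isImaginary_left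

theorem isImaginary_quatK : IsImaginary quatK := (isImaginary_iff (P := quatK) rfl).2 rfl

/-- Purely imaginary unit quaternions are conjugate to `i`, by the half turn around the bisector. -/
theorem IsImaginary.exists_conj_quatI {P : SU2} (hP : IsImaginary P) :
    ∃ u : SU2, u * quatI * u⁻¹ = P := by
  obtain ⟨x, y, z, h, hP⟩ := hP.exists_quat
  suffices ∃ u : SU2, u * quatI = P * u by
    obtain ⟨u, hu⟩ := this
    exact ⟨u, by rw [hu, mul_inv_cancel_right]⟩
  by_cases hx : x = -1
  · subst hx
    have hy : y = 0 := by nlinarith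
    have hz : z = 0 := by nlinarith
    refine ⟨quatJ, Subtype.ext ?_⟩
    simp only [Submonoid.coe_mul, quatI_coe, quatJ_coe, hP, quat_mul, quat_inj, hy, hz]
    norm_num
  · have hx' : 0 < 1 + x := by
      rcases lt_or_ge (-1) x with h' | h'
      · linarith
      · exact absurd (by nlinarith) hx
    set r := Real.sqrt ((1 + x) / 2) with hr
    have hr0 : r ≠ 0 := (Real.sqrt_pos.2 (by linarith)).ne'
    have hr2 : r ^ 2 = (1 + x) / 2 := Real.sq_sqrt (by linarith)
    have hn : 0 ^ 2 + r ^ 2 + (y / (2 * r)) ^ 2 + (z / (2 * r)) ^ 2 = 1 := by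
      field_simp
      have e : r ^ 4 = ((1 + x) / 2) ^ 2 := by rw [← hr2]; ring
      nlinarith
    refine ⟨⟨_, quat_mem hn⟩, Subtype.ext ?_⟩
    simp only [Submonoid.coe_mul, quatI_coe, hP, quat_mul, quat_inj]
    refine ⟨?_, by ring, ?_, ?_⟩
    · field_simp
      linear_combination (-2 * (1 - x)) * hr2 + h
    · field_simp
      linear_combination (-2 * z) * hr2
    · field_simp
      linear_combination (2 * y) * hr2

theorem IsImaginary.exists_conj {P Q : SU2} (hP : IsImaginary P) (hQ : IsImaginary Q) :
    ∃ u : SU2, u * P * u⁻¹ = Q := by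
  obtain ⟨u, rfl⟩ := hP.exists_conj_quatI
  obtain ⟨v, rfl⟩ := hQ.exists_conj_quatI
  exact ⟨v * u⁻¹, by group⟩

theorem IsImaginary.exists_anti {P : SU2} (hP : IsImaginary P) : ∃ B, Anti P B := by
  obtain ⟨u, rfl⟩ := hP.exists_conj_quatI
  exact ⟨_, anti_quatI_quatJ.conj u⟩

theorem center_neg_one_coe : (center (-1)).1 = -1 := by
  simp [center]

theorem IsImaginary.coe_mul_self {P : SU2} (hP : IsImaginary P) : P.1 * P.1 = -1 := by
  have h : P.1 * P.1 = (center (-1)).1 := congrArg Subtype.val hP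
  rw [h, center_neg_one_coe]

/-- For a purely imaginary `P`, the circle of all `x + y P`.  It is the centralizer of `P`. -/
def circ {P : SU2} (hP : IsImaginary P) : Circle →* SU2 where
  toFun z := ⟨((z : ℂ).re : ℂ) • 1 + ((z : ℂ).im : ℂ) • P.1, by
    obtain ⟨b, c, d, h, hP⟩ := hP.exists_quat
    rw [hP, smul_add_smul_quat]
    apply quat_mem
    have := Circle.normSq_coe z
    rw [Complex.normSq_apply] at this
    linear_combination this + (z : ℂ).im ^ 2 * h⟩
  map_one' := by
    apply Subtype.ext
    simp
  map_mul' z w := by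
    apply Subtype.ext
    simp only [Submonoid.coe_mul, Circle.coe_mul, Complex.mul_re, Complex.mul_im, mul_add, add_mul,
      smul_mul_smul_comm, one_mul, mul_one, hP.coe_mul_self, Complex.ofReal_sub,
      Complex.ofReal_add, Complex.ofReal_mul]
    module

theorem circ_coe {P : SU2} (hP : IsImaginary P) (z : Circle) :
    (circ hP z).1 = ((z : ℂ).re : ℂ) • 1 + ((z : ℂ).im : ℂ) • P.1 := rfl

theorem continuous_circ {P : SU2} (hP : IsImaginary P) : Continuous (circ hP) := by
  refine Continuous.subtype_mk ?_ _
  fun_prop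

theorem circ_injective {P : SU2} (hP : IsImaginary P) : Function.Injective (circ hP) := by
  intro z w h
  have h := congrArg Subtype.val h
  obtain ⟨b, c, d, h1, hP'⟩ := hP.exists_quat
  rw [circ_coe, circ_coe, hP', smul_add_smul_quat, smul_add_smul_quat, quat_inj] at h
  obtain ⟨h2, h3, h4, h5⟩ := h
  refine Circle.ext (Complex.ext (by simpa using h2) ?_)
  linear_combination b * h3 + c * h4 + d * h5 - ((z : ℂ).im - (w : ℂ).im) * h1

theorem circ_neg {P : SU2} (hP : IsImaginary P) (z : Circle) :
    circ hP (-z) = center (-1) * circ hP z := by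
  apply Subtype.ext
  rw [Submonoid.coe_mul, center_neg_one_coe]
  simp only [circ_coe]
  simp
  abel

theorem exists_circ_of_commute {P C : SU2} (hP : IsImaginary P) (h : Commute P C) :
    ∃ z, C = circ hP z := by
  obtain ⟨p, q, r, h1, hP'⟩ := hP.exists_quat
  obtain ⟨a, b, c, d, h1', hC⟩ := exists_quat C
  have h2 := congrArg Subtype.val h.eq
  simp only [Submonoid.coe_mul] at h2
  rw [hP', hC, quat_mul, quat_mul, quat_inj] at h2
  obtain ⟨-, h3, h4, h5⟩ := h2
  have e3 : q * d = r * c := by linarith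
  have e4 : r * b = p * d := by linarith
  have e5 : p * c = q * b := by linarith
  have hb : b = (b * p + c * q + d * r) * p := by
    linear_combination -b * h1 - q * e5 + r * e4
  have hc : c = (b * p + c * q + d * r) * q := by
    linear_combination -c * h1 + p * e5 - r * e3
  have hd : d = (b * p + c * q + d * r) * r := by
    linear_combination -d * h1 - p * e4 + q * e3
  have hn : a * a + (b * p + c * q + d * r) * (b * p + c * q + d * r) = 1 := by
    linear_combination h1' - b * hb - c * hc - d * hd
  let z : Circle := ⟨⟨a, b * p + c * q + d * r⟩, by
    refine mem_sphere_zero_iff_norm.2 ?_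
    rw [← pow_eq_one_iff_of_nonneg (norm_nonneg _) two_ne_zero, ← Complex.normSq_eq_norm_sq,
      Complex.normSq_mk, hn]⟩
  refine ⟨z, Subtype.ext ?_⟩
  rw [circ_coe, hC, hP', smul_add_smul_quat, quat_inj]
  exact ⟨by simp [z], hb, hc, hd⟩

theorem commute_circ {P : SU2} (hP : IsImaginary P) (z : Circle) : Commute P (circ hP z) := by
  apply Subtype.ext
  simp [circ_coe, mul_add, add_mul]

theorem Anti.mul_circ {P B : SU2} (h : Anti P B) (z : Circle) :
    B * circ h.isImaginary_left z = circ h.isImaginary_left z⁻¹ * B := by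
  have h2 := congrArg Subtype.val h
  apply Subtype.ext
  simp only [Submonoid.coe_mul, center_neg_one_coe] at h2
  simp [-map_inv, circ_coe, mul_add, add_mul, h2]

theorem Anti.circ_mul {P B : SU2} (h : Anti P B) (z : Circle) :
    Anti P (circ h.isImaginary_left z * B) := by
  unfold Anti at *
  rw [← mul_assoc, (commute_circ _ z).eq, mul_assoc, h, ← mul_assoc, ← center_mul_comm]
  group

/-- The elements that anticommute with `P` form a circle. -/
theorem Anti.exists_circ {P B B' : SU2} (h : Anti P B) (h' : Anti P B') :
    ∃ z, B' = circ h.isImaginary_left z * B := by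
  obtain ⟨z, hz⟩ := exists_circ_of_commute h.isImaginary_left (C := B' * B⁻¹) (by
    have e : Anti P B⁻¹ := by
      have := h.center_mul 1 (-1)
      rwa [map_one, one_mul, ← h.isImaginary_right.inv] at this
    calc P * (B' * B⁻¹) = center (-1) * B' * (P * B⁻¹) := by rw [← mul_assoc, h']; group
      _ = center (-1) * (B' * center (-1)) * B⁻¹ * P := by rw [e]; group
      _ = center (-1) * center (-1) * (B' * B⁻¹ * P) := by rw [← center_mul_comm]; group
      _ = B' * B⁻¹ * P := by rw [center_mul_self, one_mul])
  exact ⟨z, eq_mul_of_mul_inv_eq hz⟩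

/-- Only `±1` commutes with two purely imaginary unit quaternions that do not commute. -/
theorem exists_center_of_commute {P Q u : SU2} (hP : IsImaginary P) (hPQ : ¬ Commute P Q)
    (h : Commute P u) (h' : Commute Q u) : ∃ s, u = center s := by
  by_contra! hu
  obtain ⟨z, rfl⟩ := exists_circ_of_commute hP h
  have hz : (z : ℂ).im ≠ 0 := by
    intro hz
    obtain ⟨b, c, d, -, hP'⟩ := hP.exists_quat
    obtain ⟨s, hs⟩ := exists_center_of_eq (A := circ hP z) (x := (z : ℂ).re) (by
      rw [circ_coe, hP', smul_add_smul_quat]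
      simp [hz])
    exact hu s hs
  apply hPQ
  have h2 := congrArg Subtype.val h'.eq
  simp only [Submonoid.coe_mul, circ_coe, mul_add, add_mul, mul_smul_comm, smul_mul_assoc,
    one_mul, mul_one] at h2
  have h3 := add_left_cancel h2
  apply Subtype.ext
  exact (smul_right_injective _ (Complex.ofReal_ne_zero.2 hz) h3).symm

/-! ### The adjoint representation -/

theorem Ad_coe {A : SU2} {a b c d : ℝ} (h : A.1 = quat a b c d) :
    (Ad A).1 = !![a ^ 2 + b ^ 2 - c ^ 2 - d ^ 2, 2 * (b * c - a * d), 2 * (b * d + a * c);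
        2 * (b * c + a * d), a ^ 2 - b ^ 2 + c ^ 2 - d ^ 2, 2 * (c * d - a * b);
        2 * (b * d - a * c), 2 * (c * d + a * b), a ^ 2 - b ^ 2 - c ^ 2 + d ^ 2] := by
  change adMatrix A.1 = _
  rw [h]
  exact adMatrix_coords a b c d

theorem trace_Ad_iff {P : SU2} : Matrix.trace (Ad P).1 = -1 ↔ IsImaginary P := by
  obtain ⟨a, b, c, d, h, hP⟩ := exists_quat P
  rw [isImaginary_iff hP, Ad_coe hP, Matrix.trace_fin_three]
  simp only [Matrix.of_apply, Matrix.cons_val', Matrix.cons_val_zero, Matrix.cons_val_one,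
    Matrix.cons_val]
  constructor
  · intro h'
    nlinarith
  · rintro rfl
    linarith

theorem exists_center_of_Ad_eq_one {A : SU2} (h : Ad A = 1) : ∃ s, A = center s := by
  obtain ⟨a, b, c, d, h1, hA⟩ := exists_quat A
  have h := congrArg Subtype.val h
  rw [Ad_coe hA] at h
  have e0 := congrFun (congrFun h 0) 0
  have e1 := congrFun (congrFun h 1) 1
  have e2 := congrFun (congrFun h 2) 2
  simp at e0 e1 e2
  have hb : b = 0 := by nlinarith
  have hc : c = 0 := by nlinarith
  have hd : d = 0 := by nlinarith
  subst hb hc hd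
  exact exists_center_of_eq hA

/-- The kernel of `Ad` is `{±1}`. -/
theorem Ad_eq_iff {A B : SU2} : Ad A = Ad B ↔ ∃ s, A = center s * B := by
  constructor
  · intro h
    obtain ⟨s, hs⟩ := exists_center_of_Ad_eq_one (A := A * B⁻¹) (by simp [h])
    exact ⟨s, eq_mul_of_mul_inv_eq hs⟩
  · rintro ⟨s, rfl⟩
    rw [map_mul, Ad_center, one_mul]

/-- The first column of `Ad u` consists of the coordinates of `u i u⁻¹`, so it can be any unit
vector. -/
theorem exists_Ad_column {x y z : ℝ} (h : x ^ 2 + y ^ 2 + z ^ 2 = 1) :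
    ∃ u : SU2, (Ad u).1 0 0 = x ∧ (Ad u).1 1 0 = y ∧ (Ad u).1 2 0 = z := by
  let P : SU2 := ⟨quat 0 x y z, quat_mem (by rw [← h]; ring)⟩
  have hP : IsImaginary P := (isImaginary_iff (P := P) rfl).2 rfl
  obtain ⟨u, hu⟩ := hP.exists_conj_quatI
  obtain ⟨a, b, c, d, h1, hA⟩ := exists_quat u
  have hu := congrArg Subtype.val hu
  have hi : (u⁻¹).1 = star u.1 := rfl
  rw [Submonoid.coe_mul, Submonoid.coe_mul, hi, quatI_coe, hA, star_quat, quat_mul, quat_mul] at hu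
  obtain ⟨-, e0, e1, e2⟩ := quat_inj.1 hu
  refine ⟨u, ?_, ?_, ?_⟩ <;> rw [Ad_coe hA] <;> simp
  · linarith
  · linarith
  · linarith

theorem SO3_mul_transpose (R : SO3) : R.1 * R.1.transpose = 1 :=
  (Matrix.mem_orthogonalGroup_iff _ _).1 (Matrix.mem_specialOrthogonalGroup_iff.1 R.2).1

theorem SO3_transpose_mul (R : SO3) : R.1.transpose * R.1 = 1 :=
  (Matrix.mem_orthogonalGroup_iff' _ _).1 (Matrix.mem_specialOrthogonalGroup_iff.1 R.2).1

theorem SO3_inv_coe (R : SO3) : (R⁻¹).1 = R.1.transpose := rfl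

theorem SO3_det (R : SO3) : R.1.det = 1 := (Matrix.mem_specialOrthogonalGroup_iff.1 R.2).2

/-- A rotation that fixes the first basis vector is in the image of `Ad`, by halving its angle. -/
theorem exists_Ad_of_fixes {R : SO3} (h0 : R.1 0 0 = 1) (h1 : R.1 1 0 = 0) (h2 : R.1 2 0 = 0) :
    ∃ u : SU2, Ad u = R := by
  have hR := SO3_mul_transpose R
  have hd := SO3_det R
  have e00 := congrFun (congrFun hR 0) 0
  have e11 := congrFun (congrFun hR 1) 1
  have e22 := congrFun (congrFun hR 2) 2
  simp only [Matrix.mul_apply, Fin.sum_univ_three, Matrix.transpose_apply, h0, h1, h2,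
    Matrix.one_apply_eq] at e00 e11 e22
  have h01 : R.1 0 1 = 0 := by nlinarith
  have h02 : R.1 0 2 = 0 := by nlinarith
  rw [Matrix.det_fin_three, h0, h1, h2, h01, h02] at hd
  have hs : (R.1 1 1 - R.1 2 2) ^ 2 + (R.1 1 2 + R.1 2 1) ^ 2 = 0 := by
    linear_combination e11 + e22 - 2 * hd
  have h11 : R.1 2 2 = R.1 1 1 := by nlinarith [sq_nonneg (R.1 1 2 + R.1 2 1)]
  have h12 : R.1 1 2 = -R.1 2 1 := by nlinarith [sq_nonneg (R.1 1 1 - R.1 2 2)]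
  obtain ⟨w, hw⟩ := IsAlgClosed.exists_pow_nat_eq (⟨R.1 1 1, R.1 2 1⟩ : ℂ) two_pos
  have hre := congrArg Complex.re hw
  have him := congrArg Complex.im hw
  simp only [pow_two, Complex.mul_re, Complex.mul_im] at hre him
  have hn : (w.re ^ 2 + w.im ^ 2) * (w.re ^ 2 + w.im ^ 2) = 1 := by
    rw [h11, h12] at hd
    calc (w.re ^ 2 + w.im ^ 2) * (w.re ^ 2 + w.im ^ 2) =
        (w.re * w.re - w.im * w.im) ^ 2 + (w.re * w.im + w.im * w.re) ^ 2 := by ring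
      _ = 1 := by rw [hre, him]; linarith
  have hn' : w.re ^ 2 + w.im ^ 2 = 1 := by
    rcases mul_self_eq_one_iff.1 hn with h | h
    · exact h
    · nlinarith
  refine ⟨⟨quat w.re w.im 0 0, quat_mem (by linarith)⟩, Subtype.ext ?_⟩
  rw [Ad_coe (A := ⟨quat w.re w.im 0 0, _⟩) rfl]
  ext i j
  fin_cases i <;> fin_cases j <;> simp [h0, h1, h2, h01, h02, h11, h12] <;> linarith

/-- A rotation is determined by the image of the first basis vector up to a rotation that fixes
this vector. -/
theorem Ad_surjective : Function.Surjective Ad := by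
  intro R
  have hR := SO3_transpose_mul R
  have e00 := congrFun (congrFun hR 0) 0
  simp only [Matrix.mul_apply, Fin.sum_univ_three, Matrix.transpose_apply,
    Matrix.one_apply_eq] at e00
  obtain ⟨u, hx, hy, hz⟩ := exists_Ad_column (x := R.1 0 0) (y := R.1 1 0) (z := R.1 2 0)
    (by linarith)
  have hu := SO3_transpose_mul (Ad u)
  have key : ∀ i, ((Ad u)⁻¹ * R).1 i 0 = (1 : Matrix (Fin 3) (Fin 3) ℝ) i 0 := by
    intro i
    rw [← hu, Submonoid.coe_mul, SO3_inv_coe]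
    simp only [Matrix.mul_apply, Fin.sum_univ_three, hx, hy, hz]
  obtain ⟨v, hv⟩ := exists_Ad_of_fixes (R := (Ad u)⁻¹ * R) (key 0) (key 1) (key 2)
  exact ⟨u * v, by rw [map_mul, hv, mul_inv_cancel_left]⟩

theorem Ad_quatK_coe : (Ad quatK).1 = !![-1, 0, 0; 0, -1, 0; 0, 0, 1] := by
  rw [Ad_coe (A := quatK) rfl]
  ext i j
  fin_cases i <;> fin_cases j <;> simp

/-- The matrices in the copy of `O(2)` commute with the half turn around the third axis. -/
theorem commute_Ad_quatK {R : SO3} {a b c d e : ℝ} (h : R.1 = !![a, b, 0; c, d, 0; 0, 0, e]) :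
    Commute (Ad quatK) R := by
  apply Subtype.ext
  rw [Submonoid.coe_mul, Submonoid.coe_mul, Ad_quatK_coe, h]
  ext i j
  fin_cases i <;> fin_cases j <;> simp [Matrix.mul_apply, Fin.sum_univ_three]

/-- The centralizer of the half turn around the third axis is the copy of `O(2)`. -/
theorem exists_of_commute_Ad_quatK {R : SO3} (h : Commute (Ad quatK) R) :
    ∃ A ∈ Matrix.orthogonalGroup (Fin 2) ℝ,
      R.1 = !![A 0 0, A 0 1, 0; A 1 0, A 1 1, 0; 0, 0, A.det] := by
  have hc := congrArg Subtype.val h.eq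
  rw [Submonoid.coe_mul, Submonoid.coe_mul, Ad_quatK_coe] at hc
  have c02 := congrFun (congrFun hc 0) 2
  have c12 := congrFun (congrFun hc 1) 2
  have c20 := congrFun (congrFun hc 2) 0
  have c21 := congrFun (congrFun hc 2) 1
  simp [Matrix.mul_apply, Fin.sum_univ_three] at c02 c12 c20 c21
  have h02 : R.1 0 2 = 0 := by linarith
  have h12 : R.1 1 2 = 0 := by linarith
  have h20 : R.1 2 0 = 0 := by linarith
  have h21 : R.1 2 1 = 0 := by linarith
  have hR := SO3_mul_transpose R
  have hd := SO3_det R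
  have e00 := congrFun (congrFun hR 0) 0
  have e01 := congrFun (congrFun hR 0) 1
  have e11 := congrFun (congrFun hR 1) 1
  have e22 := congrFun (congrFun hR 2) 2
  simp [Matrix.mul_apply, Fin.sum_univ_three, h02, h12, h20, h21] at e00 e01 e11 e22
  rw [Matrix.det_fin_three, h02, h12, h20, h21] at hd
  refine ⟨!![R.1 0 0, R.1 0 1; R.1 1 0, R.1 1 1], ?_, ?_⟩
  · rw [Matrix.mem_orthogonalGroup_iff]
    ext i j
    fin_cases i <;> fin_cases j <;> simp [Matrix.mul_apply, Fin.sum_univ_two] <;> linarith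
  · have hdet : R.1 2 2 = R.1 0 0 * R.1 1 1 - R.1 0 1 * R.1 1 0 := by
      linear_combination (R.1 0 0 * R.1 1 1 - R.1 0 1 * R.1 1 0) * e22 - R.1 2 2 * hd
    ext i j
    fin_cases i <;> fin_cases j <;> simp [Matrix.det_fin_two, h02, h12, h20, h21, hdet]

theorem commute_of_rotation {R S : SO3} {A B : Matrix (Fin 2) (Fin 2) ℝ}
    (hA : A ∈ Matrix.specialOrthogonalGroup (Fin 2) ℝ)
    (hB : B ∈ Matrix.specialOrthogonalGroup (Fin 2) ℝ)
    (hR : R.1 = !![A 0 0, A 0 1, 0; A 1 0, A 1 1, 0; 0, 0, 1])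
    (hS : S.1 = !![B 0 0, B 0 1, 0; B 1 0, B 1 1, 0; 0, 0, 1]) : Commute R S := by
  obtain ⟨a1, a2, -⟩ := Matrix.mem_specialOrthogonalGroup_fin_two_iff.1 hA
  obtain ⟨b1, b2, -⟩ := Matrix.mem_specialOrthogonalGroup_fin_two_iff.1 hB
  apply Subtype.ext
  rw [Submonoid.coe_mul, Submonoid.coe_mul, hR, hS, a1, a2, b1, b2]
  ext i j
  fin_cases i <;> fin_cases j <;> simp [Matrix.mul_apply, Fin.sum_univ_three] <;> ring

/-! ### Central extensions and the second cohomology -/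

/-- The central extension of `G` by `{±1}` defined by a cocycle `c`: pairs of an element of `G` and
a sign, multiplied by `(g, s) * (h, t) = (g * h, s * t * c g h)`. -/
@[ext]
structure CocycleExt {G : Type} [Group G] {c : G → G → ℤˣ} (hc : IsCocycle c) where
  base : G
  sign : ℤˣ

namespace CocycleExt

variable {G : Type} [Group G] {c : G → G → ℤˣ} {hc : IsCocycle c}

-- The cocycle is not assumed to be normalized, so the neutral element carries the sign `c 1 1`.
instance : Group (CocycleExt hc) := by
  letI : Mul (CocycleExt hc) := ⟨fun x y => ⟨x.base * y.base, x.sign * y.sign * c x.base y.base⟩⟩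
  letI : One (CocycleExt hc) := ⟨⟨1, c 1 1⟩⟩
  letI : Inv (CocycleExt hc) :=
    ⟨fun x => ⟨x.base⁻¹, x.sign * c x.base⁻¹ x.base * c 1 1⟩⟩
  refine Group.ofLeftAxioms (fun x y z => ?_) (fun x => ?_) (fun x => ?_)
  · refine CocycleExt.ext (mul_assoc _ _ _) ?_
    change x.sign * y.sign * c x.base y.base * z.sign * c (x.base * y.base) z.base =
      x.sign * (y.sign * z.sign * c y.base z.base) * c x.base (y.base * z.base)
    calc _ = x.sign * y.sign * z.sign * (c (x.base * y.base) z.base * c x.base y.base) := by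
          simp only [mul_comm, mul_left_comm]
      _ = _ := by
          rw [hc]
          simp only [mul_comm, mul_left_comm]
  · refine CocycleExt.ext (one_mul _) ?_
    change c 1 1 * x.sign * c 1 x.base = x.sign
    have h := hc 1 1 x.base
    rw [one_mul, one_mul] at h
    rw [mul_right_comm, mul_left_cancel h, Int.units_mul_self, one_mul]
  · refine CocycleExt.ext (inv_mul_cancel _) ?_
    change x.sign * c x.base⁻¹ x.base * c 1 1 * x.sign * c x.base⁻¹ x.base = c 1 1
    calc _ = (x.sign * x.sign) * (c x.base⁻¹ x.base * c x.base⁻¹ x.base) * c 1 1 := by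
          simp only [mul_assoc, mul_comm, mul_left_comm]
      _ = c 1 1 := by simp only [Int.units_mul_self, one_mul]

theorem mul_base (x y : CocycleExt hc) : (x * y).base = x.base * y.base := rfl

theorem mul_sign (x y : CocycleExt hc) : (x * y).sign = x.sign * y.sign * c x.base y.base := rfl

/-- The projection of the central extension to `G`. -/
def proj (hc : IsCocycle c) : CocycleExt hc →* G := MonoidHom.mk' base mul_base

theorem proj_central (x : CocycleExt hc) (hx : proj hc x = 1) (y : CocycleExt hc) :
    x * y = y * x := by
  have hx : x.base = 1 := hx
  have h1 := hc 1 1 y.base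
  have h2 := hc y.base 1 1
  rw [one_mul, one_mul] at h1
  rw [mul_one, one_mul, mul_comm] at h2
  refine CocycleExt.ext (by rw [mul_base, mul_base, hx, one_mul, mul_one]) ?_
  rw [mul_sign, mul_sign, hx, ← mul_left_cancel h1, mul_left_cancel h2, mul_comm x.sign]

end CocycleExt

namespace PreDiagram

variable {D : PreDiagram}

/-- The class of a cocycle is determined by the commutator of the lifts of the two commuting
meridians to the central extension: if it is trivial, the extension splits. -/
theorem cohomologous_one_of_symm {c : D.LinkGroup → D.LinkGroup → ℤˣ} (hc : IsCocycle c)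
    (h : c (D.linkMeridian (D.arc 0)) D.hopfMeridian =
      c D.hopfMeridian (D.linkMeridian (D.arc 0))) :
    Cohomologous (fun _ _ => 1) c := by
  obtain ⟨φ, hφ, hφ0⟩ := D.exists_lift (CocycleExt.proj hc) CocycleExt.proj_central D.knotToLink
    (fun m => ⟨⟨D.knotToLink (D.meridian m), 1⟩, rfl⟩) ⟨D.linkMeridian (D.arc 0), 1⟩
    (D.knotToLink_meridian _).symm
  obtain ⟨Φ, hΦ, hΦb⟩ := exists_linkHom φ ⟨D.hopfMeridian, 1⟩ (by
    rw [hφ0]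
    refine CocycleExt.ext linkMeridian_commute_hopfMeridian.eq ?_
    simp only [CocycleExt.mul_sign, h])
  have hs : (CocycleExt.proj hc).comp Φ = MonoidHom.id _ :=
    linkHom_ext (by rw [MonoidHom.comp_assoc, hΦ, hφ, MonoidHom.id_comp])
      (by rw [MonoidHom.comp_apply, hΦb]; rfl)
  have hb : ∀ g, (Φ g).base = g := DFunLike.congr_fun hs
  refine ⟨fun g => (Φ g).sign, fun g h => ?_⟩
  simp only [map_mul, CocycleExt.mul_sign, hb, one_mul]
  rw [mul_comm _ (c g h), ← mul_assoc, mul_inv_cancel_right, mul_inv_cancel_right]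

/-- There is at most one nontrivial class in the second cohomology. -/
theorem cohomologous_of_nontrivial {c c' : D.LinkGroup → D.LinkGroup → ℤˣ}
    (hc : IsNontrivialCocycle c) (hc' : IsNontrivialCocycle c') : Cohomologous c c' := by
  have key : ∀ {c : D.LinkGroup → D.LinkGroup → ℤˣ}, IsNontrivialCocycle c →
      c (D.linkMeridian (D.arc 0)) D.hopfMeridian =
        -c D.hopfMeridian (D.linkMeridian (D.arc 0)) := fun hc =>
    (Int.units_ne_iff_eq_neg).1 fun h => hc.2 (cohomologous_one_of_symm hc.1 h)
  -- The commutator invariant of the product of two nontrivial cocycles is `(-1) * (-1) = 1`.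
  obtain ⟨f, hf⟩ := cohomologous_one_of_symm (c := fun g h => c g h * c' g h)
    (fun g h k => by
      rw [mul_mul_mul_comm, hc.1, hc'.1, mul_mul_mul_comm])
    (by rw [key hc, key hc', neg_mul_neg])
  refine ⟨f, fun g h => ?_⟩
  have := hf g h
  rw [one_mul] at this
  rw [← this, ← mul_assoc, Int.units_mul_self, one_mul]

end PreDiagram

/-! ### Lifts of representations in `SO(3)` to projective representations -/

/-- Any representation in `SO(3)` is the adjoint of a projective representation, for a
suitable cocycle. -/
theorem exists_projRep {G : Type} [Group G] (Φ : G →* SO3) :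
    ∃ (c : G → G → ℤˣ) (ρ : ProjRep c), IsCocycle c ∧ ρ.adjoint = Φ := by
  choose σ hσ using fun g => Ad_surjective (Φ g)
  have h : ∀ g h, ∃ s, σ (g * h) * (σ h)⁻¹ * (σ g)⁻¹ = center s := fun g h =>
    exists_center_of_Ad_eq_one (by simp [hσ])
  choose c hc using h
  have hm : ∀ g h, σ (g * h) = center (c g h) * (σ g * σ h) := fun g h => by
    rw [← hc]
    group
  refine ⟨c, ⟨σ, hc⟩, fun g h k => center_injective ?_, MonoidHom.ext hσ⟩
  have e : σ (g * h * k) = σ (g * (h * k)) := by rw [mul_assoc]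
  rw [hm, hm, hm, hm h k, ← mul_assoc (σ g), ← center_mul_comm] at e
  refine mul_right_cancel (b := σ g * σ h * σ k) ?_
  rw [map_mul, map_mul]
  simpa only [mul_assoc] using e

/-- Cohomologous cocycles have the same adjoint representations. -/
theorem exists_projRep_of_cohomologous {G : Type} [Group G] {c c' : G → G → ℤˣ}
    (h : Cohomologous c c') (ρ : ProjRep c) : ∃ ρ' : ProjRep c', ρ'.adjoint = ρ.adjoint := by
  obtain ⟨f, hf⟩ := h
  refine ⟨⟨fun g => center (f g) * ρ.1 g, fun g h => ?_⟩, MonoidHom.ext fun g => ?_⟩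
  · have hz := fun s => Subgroup.mem_center_iff.1 (center_mem_center s)
    rw [hf, map_mul, map_mul, map_mul, map_inv, map_inv, ← ρ.2, mul_inv_rev, mul_inv_rev]
    calc center (f (g * h)) * ρ.1 (g * h) * ((ρ.1 h)⁻¹ * (center (f h))⁻¹) *
          ((ρ.1 g)⁻¹ * (center (f g))⁻¹)
        = center (f (g * h)) * (ρ.1 (g * h) * (ρ.1 h)⁻¹) * ((center (f h))⁻¹ * (ρ.1 g)⁻¹) *
          (center (f g))⁻¹ := by group
      _ = (center (f (g * h)) * (ρ.1 (g * h) * (ρ.1 h)⁻¹ * (ρ.1 g)⁻¹)) * (center (f h))⁻¹ *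
          (center (f g))⁻¹ := by rw [center_inv, ← hz (f h) (ρ.1 g)⁻¹]; group
      _ = _ := by rw [← hz]; group
  · change Ad (center (f g) * ρ.1 g) = Ad (ρ.1 g)
    rw [map_mul, Ad_center, one_mul]

namespace PreDiagram

variable {D : PreDiagram}

/-- The representation of the link group in `SO(3)` induced by a representation `A` of the knot
group in `SU(2)` and an element `B` that commutes with the first meridian up to sign. -/
theorem exists_adjoint_linkHom (A : D.KnotGroup →* SU2) {B : SU2}
    (h : Anti (A (D.meridian (D.arc 0))) B) :
    ∃ Φ : D.LinkGroup →* SO3, Φ.comp D.knotToLink = Ad.comp A ∧ Φ D.hopfMeridian = Ad B :=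
  exists_linkHom (Ad.comp A) (Ad B) (by
    rw [MonoidHom.comp_apply, Commute, SemiconjBy, ← map_mul, h, map_mul, Ad_center, one_mul,
      map_mul])

/-- The cocycle of a projective representation that sends the two commuting meridians to
anticommuting elements is not a coboundary. -/
theorem isNontrivialCocycle_of_anti {c : D.LinkGroup → D.LinkGroup → ℤˣ} (hc : IsCocycle c)
    (ρ : ProjRep c) (h : Anti (ρ.1 (D.linkMeridian (D.arc 0))) (ρ.1 D.hopfMeridian)) :
    IsNontrivialCocycle c := by
  refine ⟨hc, ?_⟩
  rintro ⟨f, hf⟩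
  have hm := linkMeridian_commute_hopfMeridian (D := D)
  have hsymm : c (D.linkMeridian (D.arc 0)) D.hopfMeridian =
      c D.hopfMeridian (D.linkMeridian (D.arc 0)) := by
    rw [hf, hf, hm.eq, mul_assoc, mul_assoc, mul_comm (f D.hopfMeridian)⁻¹]
  have h1 := ρ.map_mul (D.linkMeridian (D.arc 0)) D.hopfMeridian
  rw [hm.eq, ρ.map_mul, hsymm] at h1
  have h2 := mul_left_cancel h1
  rw [h] at h2
  exact center_neg_one_ne_one (mul_eq_right.1 h2.symm)

/-- A pair `(A, B)` with anticommuting values on the two meridians gives a projective representation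
for some nontrivial cocycle. -/
theorem exists_anti_projRep (A : D.KnotGroup →* SU2) {B : SU2}
    (h : Anti (A (D.meridian (D.arc 0))) B) :
    ∃ (c : D.LinkGroup → D.LinkGroup → ℤˣ) (ρ : ProjRep c), IsNontrivialCocycle c ∧
      ρ.adjoint.comp D.knotToLink = Ad.comp A ∧ ρ.adjoint D.hopfMeridian = Ad B := by
  obtain ⟨Φ, h1, h2⟩ := exists_adjoint_linkHom A h
  obtain ⟨c, ρ, hc, hρ⟩ := exists_projRep Φ
  refine ⟨c, ρ, isNontrivialCocycle_of_anti hc ρ ?_, by rw [hρ, h1], by rw [hρ, h2]⟩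
  have ha := DFunLike.congr_fun h1 (D.meridian (D.arc 0))
  rw [MonoidHom.comp_apply, knotToLink_meridian, ← hρ] at ha
  obtain ⟨s, hs⟩ := Ad_eq_iff.1 ha
  rw [← hρ] at h2
  obtain ⟨t, ht⟩ := Ad_eq_iff.1 h2
  rw [hs, ht]
  exact h.center_mul s t

theorem anti_constHom : Anti (D.constHom quatI (D.meridian (D.arc 0))) quatJ := by
  rw [constHom_meridian]
  exact anti_quatI_quatJ

/-- The pair `(i, j)` of anticommuting quaternions defines a nontrivial cocycle. -/
theorem exists_nontrivialCocycle : ∃ c : D.LinkGroup → D.LinkGroup → ℤˣ, IsNontrivialCocycle c :=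
  let ⟨c, _, hc, _⟩ := exists_anti_projRep _ (anti_constHom (D := D))
  ⟨c, hc⟩

/-- The homomorphism of the free group on the meridians that is given by a representation `A` of the
knot group and the image `B` of the meridian of `ℓ`. -/
def freeHom {E : Type*} [Group E] (A : D.KnotGroup →* E) (B : E) : FreeGroup D.LinkGen →* E :=
  FreeGroup.lift (Sum.elim (fun m => A (D.meridian m)) fun _ => B)

@[simp]
theorem freeHom_inl {E : Type*} [Group E] (A : D.KnotGroup →* E) (B : E) (m : D.Arc) :
    freeHom A B (FreeGroup.of (Sum.inl m)) = A (D.meridian m) :=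
  FreeGroup.lift_apply_of

@[simp]
theorem freeHom_inr {E : Type*} [Group E] (A : D.KnotGroup →* E) (B : E) :
    freeHom A B (FreeGroup.of (Sum.inr ())) = B :=
  FreeGroup.lift_apply_of

theorem freeHom_unique {E : Type*} [Group E] {A : D.KnotGroup →* E} {B : E}
    {L : FreeGroup D.LinkGen →* E} (hA : ∀ m, L (FreeGroup.of (Sum.inl m)) = A (D.meridian m))
    (hB : L (FreeGroup.of (Sum.inr ())) = B) : L = freeHom A B := by
  refine FreeGroup.ext_hom _ _ fun x => ?_
  rcases x with m | ⟨⟩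
  · rw [hA, freeHom_inl]
  · rw [hB, freeHom_inr]

theorem freeHom_map_inl {E : Type*} [Group E] (A : D.KnotGroup →* E) (B : E)
    (w : FreeGroup D.Arc) :
    freeHom A B (FreeGroup.map Sum.inl w) = A (PresentedGroup.mk D.relators w) := by
  have e : (freeHom A B).comp (FreeGroup.map Sum.inl) =
      A.comp (PresentedGroup.mk D.relators) := by
    ext m
    simp [PresentedGroup.of]
  exact DFunLike.congr_fun e w

theorem isAlpha_iff {c : D.LinkGroup → D.LinkGroup → ℤˣ} (ρ : ProjRep c) :
    D.IsAlpha ρ ↔ ∀ w, ∃ s, ρ.1 (PresentedGroup.mk D.linkRelators w) =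
      center s * freeHom (D.constHom quatI) quatJ w := by
  have e : freeHom (D.constHom quatI) quatJ =
      FreeGroup.lift (Sum.elim (fun _ => quatI) (fun _ => quatJ)) := by
    simp [freeHom]
  rw [IsAlpha, e]

/-- As there is only one nontrivial class, the special projective representation exists for
every cocycle in it. -/
theorem exists_isAlpha {c : D.LinkGroup → D.LinkGroup → ℤˣ} (hc : IsNontrivialCocycle c) :
    ∃ α : ProjRep c, D.IsAlpha α := by
  obtain ⟨c', ρ', hc', h1, h2⟩ := exists_anti_projRep _ (anti_constHom (D := D))
  obtain ⟨ρ, hρ⟩ := exists_projRep_of_cohomologous (cohomologous_of_nontrivial hc' hc) ρ'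
  refine ⟨ρ, (isAlpha_iff ρ).2 fun w => ?_⟩
  rw [← Ad_eq_iff]
  rw [← hρ] at h1 h2
  have e : ρ.adjoint.comp (PresentedGroup.mk D.linkRelators) =
      Ad.comp (freeHom (D.constHom quatI) quatJ) := by
    refine FreeGroup.ext_hom _ _ fun x => ?_
    rcases x with m | ⟨⟩
    · have := DFunLike.congr_fun h1 (D.meridian m)
      rw [MonoidHom.comp_apply, knotToLink_meridian] at this
      rw [MonoidHom.comp_apply, MonoidHom.comp_apply, freeHom_inl]
      exact this
    · rw [MonoidHom.comp_apply, MonoidHom.comp_apply, freeHom_inr]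
      exact h2
  exact DFunLike.congr_fun e w

end PreDiagram

/-! ### The topology of `SU(2)` -/

instance : ContinuousInv SU2 :=
  ⟨Continuous.subtype_mk (continuous_star.comp continuous_subtype_val) _⟩

instance : CompactSpace SU2 := by
  have hc : IsClosed (Matrix.specialUnitaryGroup (Fin 2) ℂ : Set (Matrix (Fin 2) (Fin 2) ℂ)) := by
    have e : (Matrix.specialUnitaryGroup (Fin 2) ℂ : Set (Matrix (Fin 2) (Fin 2) ℂ)) =
        {A | A * star A = 1} ∩ {A | A.det = 1} := by
      ext A
      rw [SetLike.mem_coe, Matrix.mem_specialUnitaryGroup_iff, Matrix.mem_unitaryGroup_iff]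
      rfl
    rw [e]
    refine (isClosed_eq ?_ continuous_const).inter
      (isClosed_eq continuous_id.matrix_det continuous_const)
    exact continuous_id.mul continuous_star
  refine isCompact_iff_compactSpace.1 (IsCompact.of_isClosed_subset (s := Set.univ.pi fun _ =>
    Set.univ.pi fun _ => Metric.closedBall 0 1) (isCompact_univ_pi fun _ => isCompact_univ_pi
      fun _ => isCompact_closedBall 0 1) hc ?_)
  intro A hA i _ j _
  rw [mem_closedBall_zero_iff]
  exact entry_norm_bound_of_unitary (Matrix.mem_specialUnitaryGroup_iff.1 hA).1 i j

/-! ### A parametrization of the projective representations -/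

namespace PreDiagram

variable {D : PreDiagram}

/-- The pairs `(A, B)` with anticommuting values on the two meridians all send a word that is
trivial in the link group to the same sign: this holds for the defining relators. -/
theorem exists_center_freeHom {A : D.KnotGroup →* SU2} {B : SU2}
    (h : Anti (A (D.meridian (D.arc 0))) B) {w : FreeGroup D.LinkGen}
    (hw : PresentedGroup.mk D.linkRelators w = 1) :
    ∃ s, freeHom A B w = center s ∧ freeHom (D.constHom quatI) quatJ w = center s := by
  let N : Subgroup (FreeGroup D.LinkGen) := (center.prod center).range.comap
    ((freeHom A B).prod (freeHom (D.constHom quatI) quatJ))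
  have hN : N.Normal := by
    refine ⟨fun w hw v => ?_⟩
    obtain ⟨s, hs⟩ := hw
    refine ⟨s, ?_⟩
    rw [map_mul, map_mul, map_inv, ← hs]
    refine Prod.ext ?_ ?_
    · change center s = _ * center s * _⁻¹
      rw [← center_mul_comm, mul_inv_cancel_right]
    · change center s = _ * center s * _⁻¹
      rw [← center_mul_comm, mul_inv_cancel_right]
  have hle : Subgroup.normalClosure D.linkRelators ≤ N := by
    refine Subgroup.normalClosure_le_normal ?_
    rintro r (⟨r, hr, rfl⟩ | rfl)
    · refine ⟨1, ?_⟩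
      change _ = (freeHom A B _, freeHom (D.constHom quatI) quatJ _)
      rw [freeHom_map_inl, freeHom_map_inl, PresentedGroup.one_of_mem hr, map_one, map_one, map_one]
      rfl
    · have key : ∀ {A : D.KnotGroup →* SU2} {B : SU2}, Anti (A (D.meridian (D.arc 0))) B →
          freeHom A B (FreeGroup.of (Sum.inl (D.arc 0)) * FreeGroup.of (Sum.inr ()) *
            (FreeGroup.of (Sum.inl (D.arc 0)))⁻¹ * (FreeGroup.of (Sum.inr ()))⁻¹) =
              center (-1) := by
        intro A B h
        rw [map_mul, map_mul, map_mul, map_inv, map_inv, freeHom_inl, freeHom_inr, h]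
        group
      exact ⟨-1, Prod.ext (key h).symm (key anti_constHom).symm⟩
  obtain ⟨s, hs⟩ := hle (PresentedGroup.mk_eq_one_iff.1 hw)
  exact ⟨s, (congrArg Prod.fst hs).symm, (congrArg Prod.snd hs).symm⟩

variable {c : D.LinkGroup → D.LinkGroup → ℤˣ} {α : ProjRep c}

/-- The sign by which the special projective representation `α` differs on a word from the
homomorphism of the free group that sends the meridians to `i` and `j`. -/
def wordSign (hα : D.IsAlpha α) (w : FreeGroup D.LinkGen) : ℤˣ := ((isAlpha_iff α).1 hα w).choose

theorem wordSign_spec (hα : D.IsAlpha α) (w : FreeGroup D.LinkGen) :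
    α.1 (PresentedGroup.mk D.linkRelators w) =
      center (wordSign hα w) * freeHom (D.constHom quatI) quatJ w :=
  ((isAlpha_iff α).1 hα w).choose_spec

theorem wordSign_mul (hα : D.IsAlpha α) (w v : FreeGroup D.LinkGen) :
    wordSign hα (w * v) = c (PresentedGroup.mk _ w) (PresentedGroup.mk _ v) *
      (wordSign hα w * wordSign hα v) := by
  have h := α.map_mul (PresentedGroup.mk _ w) (PresentedGroup.mk _ v)
  rw [← map_mul, wordSign_spec hα, wordSign_spec hα, wordSign_spec hα, map_mul] at h
  refine center_injective (mul_right_cancel (h.trans ?_))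
  rw [map_mul, map_mul]
  calc _ = center (c (PresentedGroup.mk _ w) (PresentedGroup.mk _ v)) * center (wordSign hα w) *
        (freeHom (D.constHom quatI) quatJ w * center (wordSign hα v)) *
          freeHom (D.constHom quatI) quatJ v := by group
    _ = _ := by rw [← center_mul_comm (wordSign hα v)]; group

/-- With the signs of `α`, any pair `(A, B)` gives a well-defined function on the link group. -/
theorem wordSign_mul_freeHom_eq (hα : D.IsAlpha α) {A : D.KnotGroup →* SU2} {B : SU2}
    (h : Anti (A (D.meridian (D.arc 0))) B) {w v : FreeGroup D.LinkGen}
    (hwv : PresentedGroup.mk D.linkRelators w = PresentedGroup.mk _ v) :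
    center (wordSign hα w) * freeHom A B w = center (wordSign hα v) * freeHom A B v := by
  obtain ⟨s, h1, h2⟩ := exists_center_freeHom h (w := w * v⁻¹) (by simp [hwv])
  have h3 := (wordSign_spec hα w).symm.trans ((congrArg α.1 hwv).trans (wordSign_spec hα v))
  rw [map_mul, map_inv, mul_inv_eq_iff_eq_mul] at h1 h2
  rw [h2, ← mul_assoc] at h3
  rw [h1, ← mul_assoc, mul_right_cancel h3]

/-- The projective representation with parameters `(A, B)`, where `A` is a representation of
the knot group in `SU(2)`, and `B` is the image of the meridian of `ℓ`; the signs are taken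
from `α`, which has the parameters `(i, j)`. -/
def rep (hα : D.IsAlpha α) (A : D.KnotGroup →* SU2) (B : SU2)
    (h : Anti (A (D.meridian (D.arc 0))) B) : ProjRep c :=
  let σ := Function.surjInv (PresentedGroup.mk_surjective D.linkRelators)
  ⟨fun g => center (wordSign hα (σ g)) * freeHom A B (σ g), fun g g' => by
    have hσ : ∀ g, PresentedGroup.mk D.linkRelators (σ g) = g := Function.surjInv_eq _
    have e := wordSign_mul_freeHom_eq hα h (w := σ (g * g')) (v := σ g * σ g') (by
      rw [map_mul, hσ, hσ, hσ])
    beta_reduce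
    rw [e, wordSign_mul, hσ, hσ, map_mul, map_mul, map_mul]
    calc center (c g g') * (center (wordSign hα (σ g)) * center (wordSign hα (σ g'))) *
          (freeHom A B (σ g) * freeHom A B (σ g')) *
          (center (wordSign hα (σ g')) * freeHom A B (σ g'))⁻¹ *
          (center (wordSign hα (σ g)) * freeHom A B (σ g))⁻¹
        = center (c g g') * center (wordSign hα (σ g)) * (center (wordSign hα (σ g')) *
          freeHom A B (σ g)) * (center (wordSign hα (σ g')))⁻¹ * (freeHom A B (σ g))⁻¹ *
          (center (wordSign hα (σ g)))⁻¹ := by group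
      _ = center (c g g') := by
          rw [center_mul_comm (wordSign hα (σ g'))]
          group⟩

theorem rep_mk (hα : D.IsAlpha α) {A : D.KnotGroup →* SU2} {B : SU2}
    (h : Anti (A (D.meridian (D.arc 0))) B) (w : FreeGroup D.LinkGen) :
    (rep hα A B h).1 (PresentedGroup.mk _ w) = center (wordSign hα w) * freeHom A B w :=
  wordSign_mul_freeHom_eq hα h (Function.surjInv_eq (PresentedGroup.mk_surjective _) _)

theorem eq_rep (hα : D.IsAlpha α) {A : D.KnotGroup →* SU2} {B : SU2}
    (h : Anti (A (D.meridian (D.arc 0))) B) {ρ : ProjRep c}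
    (hρ : ∀ w, ρ.1 (PresentedGroup.mk _ w) = center (wordSign hα w) * freeHom A B w) :
    ρ = rep hα A B h := by
  refine Subtype.ext (funext fun g => ?_)
  obtain ⟨w, rfl⟩ := PresentedGroup.mk_surjective _ g
  rw [hρ, rep_mk]

/-- The special projective representation has the parameters `(i, j)`. -/
theorem alpha_eq_rep (hα : D.IsAlpha α) :
    α = rep hα (D.constHom quatI) quatJ anti_constHom :=
  eq_rep hα _ (wordSign_spec hα)

/-- Every projective representation with cocycle `c` has parameters. -/
theorem exists_eq_rep (hα : D.IsAlpha α) (ρ : ProjRep c) : ∃ A B h, ρ = rep hα A B h := by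
  let L : FreeGroup D.LinkGen →* SU2 := MonoidHom.mk'
    (fun w => center (wordSign hα w) * ρ.1 (PresentedGroup.mk _ w)) (fun w v => by
      rw [map_mul, ρ.map_mul, wordSign_mul, map_mul, map_mul]
      set x := PresentedGroup.mk D.linkRelators w
      set y := PresentedGroup.mk D.linkRelators v
      calc center (c x y) * (center (wordSign hα w) * center (wordSign hα v)) *
            (center (c x y) * (ρ.1 x * ρ.1 y))
          = (center (c x y) * (center (wordSign hα w) * center (wordSign hα v) *
              center (c x y))) * (ρ.1 x * ρ.1 y) := by group
        _ = (center (c x y) * center (c x y)) * (center (wordSign hα w) *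
              (center (wordSign hα v) * ρ.1 x) * ρ.1 y) := by
            rw [← center_mul_comm (c x y)]; group
        _ = _ := by rw [center_mul_self, center_mul_comm (wordSign hα v)]; group)
  have hL : ∀ w, ρ.1 (PresentedGroup.mk _ w) = center (wordSign hα w) * L w := by
    intro w
    change _ = center (wordSign hα w) * (center (wordSign hα w) * ρ.1 (PresentedGroup.mk _ w))
    rw [← mul_assoc, center_mul_self, one_mul]
  have h1 : ∀ ρ : ProjRep c, ρ.1 1 = center (c 1 1) := fun ρ => by
    have := ρ.map_mul 1 1
    rw [mul_one, ← mul_assoc, right_eq_mul] at this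
    rw [eq_inv_of_mul_eq_one_right this, center_inv]
  -- A word that is trivial in the link group is sent by `L` to the same sign as by the
  -- homomorphism that belongs to `α`.
  have hker : ∀ w, PresentedGroup.mk D.linkRelators w = 1 →
      L w = freeHom (D.constHom quatI) quatJ w := by
    intro w hw
    have e := (hL w).symm.trans ((congrArg ρ.1 hw).trans ((h1 ρ).trans ((h1 α).symm.trans
      ((congrArg α.1 hw.symm).trans (wordSign_spec hα w)))))
    exact mul_left_cancel e
  let A : D.KnotGroup →* SU2 := PresentedGroup.toGroup
    (f := fun m => L (FreeGroup.of (Sum.inl m))) (by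
      intro r hr
      have e : FreeGroup.lift (fun m => L (FreeGroup.of (Sum.inl m))) =
          L.comp (FreeGroup.map Sum.inl) := by
        ext m
        simp
      rw [e, MonoidHom.comp_apply, hker, freeHom_map_inl, PresentedGroup.one_of_mem hr, map_one]
      exact PresentedGroup.one_of_mem (rels := D.linkRelators) (Or.inl ⟨r, hr, rfl⟩))
  have hA : ∀ m, A (D.meridian m) = L (FreeGroup.of (Sum.inl m)) := fun m =>
    PresentedGroup.toGroup.of _
  have hLA : L = freeHom A (L (FreeGroup.of (Sum.inr ()))) :=
    freeHom_unique (fun m => (hA m).symm) rfl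
  have hanti : Anti (A (D.meridian (D.arc 0))) (L (FreeGroup.of (Sum.inr ()))) := by
    have e := hker _ (PresentedGroup.one_of_mem (rels := D.linkRelators) (Or.inr rfl))
    rw [map_mul, map_mul, map_mul, map_inv, map_inv, map_mul, map_mul, map_mul, map_inv, map_inv,
      freeHom_inl, freeHom_inr, constHom_meridian, anti_quatI_quatJ, ← hA] at e
    rw [mul_inv_eq_iff_eq_mul, mul_inv_eq_iff_eq_mul] at e
    rw [Anti, e]
    group
  exact ⟨A, _, hanti, eq_rep hα hanti fun w => by rw [hL, ← hLA]⟩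

theorem rep_congr (hα : D.IsAlpha α) {A A' : D.KnotGroup →* SU2} {B B' : SU2}
    {h : Anti (A (D.meridian (D.arc 0))) B} {h' : Anti (A' (D.meridian (D.arc 0))) B'}
    (hA : A = A') (hB : B = B') : rep hα A B h = rep hα A' B' h' := by
  subst hA hB
  rfl

/-- Conjugate parameters are the parameters of conjugate projective representations. -/
theorem mk_rep_eq_iff (hα : D.IsAlpha α) {A A' : D.KnotGroup →* SU2} {B B' : SU2}
    {h : Anti (A (D.meridian (D.arc 0))) B} {h' : Anti (A' (D.meridian (D.arc 0))) B'} :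
    (Quotient.mk _ (rep hα A B h) : PR c) = Quotient.mk _ (rep hα A' B' h') ↔
      ∃ u : SU2, (∀ m, A' (D.meridian m) = u * A (D.meridian m) * u⁻¹) ∧ B' = u * B * u⁻¹ := by
  rw [Quotient.eq]
  constructor
  · rintro ⟨u, hu⟩
    have key : ∀ w, freeHom A' B' w = u * freeHom A B w * u⁻¹ := by
      intro w
      have := hu (PresentedGroup.mk _ w)
      rw [rep_mk, rep_mk, ← mul_assoc u, ← center_mul_comm] at this
      refine mul_left_cancel (this.trans ?_)
      group
    refine ⟨u, fun m => ?_, ?_⟩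
    · simpa using key (FreeGroup.of (Sum.inl m))
    · simpa using key (FreeGroup.of (Sum.inr ()))
  · rintro ⟨u, hA, hB⟩
    refine ⟨u, fun g => ?_⟩
    obtain ⟨w, rfl⟩ := PresentedGroup.mk_surjective _ g
    have e : ((MulAut.conj u).toMonoidHom).comp (freeHom A B) = freeHom A' B' :=
      freeHom_unique (fun m => by simp [hA]) (by simp [hB])
    rw [rep_mk, rep_mk, ← e, ← mul_assoc u, ← center_mul_comm]
    change _ * (u * freeHom A B w * u⁻¹) = _
    group

/-- The product of a representation in `SU(2)` with the character that takes the value `s` on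
all meridians. -/
def signTwist (s : ℤˣ) (A : D.KnotGroup →* SU2) : D.KnotGroup →* SU2 :=
  MonoidHom.mk' (fun g => center (D.constHom s g) * A g) (fun g h => by
    rw [map_mul, map_mul, map_mul]
    calc center (D.constHom s g) * center (D.constHom s h) * (A g * A h)
        = center (D.constHom s g) * (center (D.constHom s h) * A g) * A h := by group
      _ = _ := by rw [center_mul_comm (D.constHom s h)]; group)

@[simp]
theorem signTwist_meridian (s : ℤˣ) (A : D.KnotGroup →* SU2) (m : D.Arc) :
    signTwist s A (D.meridian m) = center s * A (D.meridian m) := by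
  change center (D.constHom s (D.meridian m)) * _ = _
  rw [constHom_meridian]

theorem knotHom_ext {E : Type*} [Group E] {A A' : D.KnotGroup →* E}
    (h : ∀ m, A (D.meridian m) = A' (D.meridian m)) : A = A' :=
  PresentedGroup.ext h

theorem signTwist_one (A : D.KnotGroup →* SU2) : signTwist 1 A = A :=
  knotHom_ext fun m => by simp

theorem signTwist_signTwist (s t : ℤˣ) (A : D.KnotGroup →* SU2) :
    signTwist s (signTwist t A) = signTwist (s * t) A :=
  knotHom_ext fun m => by simp [mul_assoc]

theorem Ad_comp_signTwist (s : ℤˣ) (A : D.KnotGroup →* SU2) :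
    Ad.comp (signTwist s A) = Ad.comp A :=
  knotHom_ext fun m => by
    rw [MonoidHom.comp_apply, signTwist_meridian, map_mul, Ad_center, one_mul]
    rfl

theorem anti_signTwist {A : D.KnotGroup →* SU2} {B : SU2}
    (h : Anti (A (D.meridian (D.arc 0))) B) (s t : ℤˣ) :
    Anti (signTwist s A (D.meridian (D.arc 0))) (center t * B) := by
  rw [signTwist_meridian]
  exact h.center_mul s t

theorem character_smul_rep (hα : D.IsAlpha α) {A : D.KnotGroup →* SU2} {B : SU2}
    (h : Anti (A (D.meridian (D.arc 0))) B) (s t : ℤˣ) :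
    D.character s t • (Quotient.mk _ (rep hα A B h) : PR c) =
      Quotient.mk _ (rep hα (signTwist s A) (center t * B) (anti_signTwist h s t)) := by
  refine congrArg (Quotient.mk (ProjRep.conj c)) (eq_rep hα _ fun w => ?_)
  have e : freeHom (signTwist s A) (center t * B) w =
      center (D.character s t (PresentedGroup.mk _ w)) * freeHom A B w := by
    let L : FreeGroup D.LinkGen →* SU2 := MonoidHom.mk'
      (fun w => center (D.character s t (PresentedGroup.mk _ w)) * freeHom A B w) (fun w v => by
        rw [map_mul, map_mul, map_mul, map_mul]
        calc _ = center (D.character s t (PresentedGroup.mk _ w)) *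
              (center (D.character s t (PresentedGroup.mk _ v)) * freeHom A B w) *
                freeHom A B v := by group
          _ = _ := by rw [center_mul_comm (D.character s t (PresentedGroup.mk _ v))]; group)
    have hL : L = freeHom (signTwist s A) (center t * B) := by
      refine freeHom_unique (fun m => ?_) ?_
      · change center (D.character s t (D.linkMeridian m)) * _ = _
        rw [character_linkMeridian, freeHom_inl, signTwist_meridian]
      · change center (D.character s t D.hopfMeridian) * _ = _
        rw [character_hopfMeridian, freeHom_inr]
    rw [← hL]
    rfl
  change center (D.character s t (PresentedGroup.mk _ w)) * (rep hα A B h).1 _ = _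
  rw [rep_mk, e, ← mul_assoc, ← mul_assoc, ← map_mul, ← map_mul, mul_comm]

theorem psi_rep (hα : D.IsAlpha α) {A : D.KnotGroup →* SU2} {B : SU2}
    (h : Anti (A (D.meridian (D.arc 0))) B) :
    D.psi c (Quotient.mk _ (rep hα A B h)) = Quotient.mk _ (Ad.comp A) := by
  refine congrArg (Quotient.mk (conjSO3 D.KnotGroup)) (knotHom_ext fun m => ?_)
  rw [MonoidHom.comp_apply, knotToLink_meridian]
  change Ad ((rep hα A B h).1 (PresentedGroup.mk _ (FreeGroup.of (Sum.inl m)))) = _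
  rw [rep_mk, map_mul, Ad_center, one_mul, freeHom_inl]
  rfl

/-- The projective representation depends continuously on the image of the meridian of `ℓ`. -/
theorem continuous_rep (hα : D.IsAlpha α) (A : D.KnotGroup →* SU2) {X : Type*} [TopologicalSpace X]
    {B : X → SU2} (hB : Continuous B) (h : ∀ x, Anti (A (D.meridian (D.arc 0))) (B x)) :
    Continuous fun x => rep hα A (B x) (h x) := by
  have key : ∀ w, Continuous fun x => freeHom A (B x) w := by
    intro w
    induction w using FreeGroup.induction_on with
    | C1 => simpa only [map_one] using continuous_const
    | of x =>
      rcases x with m | ⟨⟩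
      · simpa only [freeHom_inl] using continuous_const
      · exact hB.congr fun x => (freeHom_inr A (B x)).symm
    | inv_of x hx =>
      simp only [map_inv]
      exact hx.inv
    | mul v w hv hw =>
      simp only [map_mul]
      exact hv.mul hw
  exact Continuous.subtype_mk (continuous_pi fun g => continuous_const.mul (key _)) _

end PreDiagram

/-! ### Topology of the spaces of projective representations -/

section Topology

variable {G : Type} [Group G] {c : G → G → ℤˣ}

/-- The conjugate of a projective representation by an element of `SU(2)`. -/
def ProjRep.conjBy (u : SU2) (ρ : ProjRep c) : ProjRep c :=
  ⟨fun g => u * ρ.1 g * u⁻¹, fun g h => by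
    calc u * ρ.1 (g * h) * u⁻¹ * (u * ρ.1 h * u⁻¹)⁻¹ * (u * ρ.1 g * u⁻¹)⁻¹
        = u * (ρ.1 (g * h) * (ρ.1 h)⁻¹ * (ρ.1 g)⁻¹) * u⁻¹ := by group
      _ = center (c g h) := by rw [ρ.2, ← center_mul_comm, mul_inv_cancel_right]⟩

theorem ProjRep.continuous_conjBy (u : SU2) : Continuous (ProjRep.conjBy (c := c) u) := by
  refine Continuous.subtype_mk (continuous_pi fun g => ?_) _
  exact (continuous_const.mul ((continuous_apply g).comp continuous_subtype_val)).mul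
    continuous_const

theorem isOpenQuotientMap_mk :
    IsOpenQuotientMap (Quotient.mk (ProjRep.conj c) : ProjRep c → PR c) := by
  refine ⟨Quotient.mk_surjective, continuous_quotient_mk', fun U hU => ?_⟩
  rw [← isQuotientMap_quotient_mk'.isOpen_preimage]
  have e : Quotient.mk (ProjRep.conj c) ⁻¹' (Quotient.mk (ProjRep.conj c) '' U) =
      ⋃ u, ProjRep.conjBy u ⁻¹' U := by
    ext ρ
    simp only [Set.mem_preimage, Set.mem_image, Set.mem_iUnion]
    constructor
    · rintro ⟨ρ', hρ', h⟩
      obtain ⟨u, hu⟩ := Quotient.exact h.symm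
      refine ⟨u, ?_⟩
      rwa [show ProjRep.conjBy u ρ = ρ' from Subtype.ext (funext fun g => (hu g).symm)]
    · rintro ⟨u, hu⟩
      exact ⟨_, hu, (Quotient.sound ⟨u, fun g => rfl⟩ : Quotient.mk (ProjRep.conj c) ρ = _).symm⟩
  exact e ▸ isOpen_iUnion fun u => hU.preimage (ProjRep.continuous_conjBy u)

/-- The space of conjugacy classes is Hausdorff, because `SU(2)` is compact. -/
instance : T2Space (PR c) := by
  rw [t2Space_iff_of_isOpenQuotientMap isOpenQuotientMap_mk]
  have e : {q : ProjRep c × ProjRep c | (Quotient.mk _ q.1 : PR c) = Quotient.mk _ q.2} =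
      Prod.snd '' {x : SU2 × (ProjRep c × ProjRep c) |
        ∀ g, x.2.2.1 g = x.1 * x.2.1.1 g * x.1⁻¹} := by
    ext q
    rw [Set.mem_ofPred_eq, Quotient.eq]
    constructor
    · rintro ⟨u, hu⟩
      exact ⟨(u, q), hu, rfl⟩
    · rintro ⟨⟨u, q⟩, hu, rfl⟩
      exact ⟨u, hu⟩
  rw [e]
  refine isClosedMap_snd_of_compactSpace _ ?_
  rw [Set.ofPred_forall]
  refine isClosed_iInter fun g => isClosed_eq ?_ ?_
  · exact (continuous_apply g).comp
      (continuous_subtype_val.comp (continuous_snd.comp continuous_snd))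
  · have h1 : Continuous fun x : SU2 × (ProjRep c × ProjRep c) => x.1 := continuous_fst
    exact (h1.mul ((continuous_apply g).comp
      (continuous_subtype_val.comp (continuous_fst.comp continuous_snd)))).mul h1.inv

theorem continuous_character_smul (χ : G →* ℤˣ) : Continuous fun x : PR c => χ • x := by
  refine isOpenQuotientMap_mk.isQuotientMap.continuous_iff.2 ?_
  refine continuous_quotient_mk'.comp (f := ProjRep.twist χ) ?_
  refine Continuous.subtype_mk (continuous_pi fun g => ?_) _
  exact continuous_const.mul ((continuous_apply g).comp continuous_subtype_val)

end Topology

/-! ### Reducible and dihedral representations of the knot group -/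

namespace PreDiagram

variable {D : PreDiagram}

/-- Every representation of the knot group in `SO(3)` lifts to `SU(2)`. -/
theorem exists_Ad_comp_eq (ρ : D.KnotGroup →* SO3) : ∃ A : D.KnotGroup →* SU2, Ad.comp A = ρ := by
  obtain ⟨P, hP⟩ := Ad_surjective (ρ (D.meridian (D.arc 0)))
  obtain ⟨A, hA, -⟩ := D.exists_lift Ad (fun x hx y => by
    obtain ⟨s, rfl⟩ := exists_center_of_Ad_eq_one hx
    exact center_mul_comm s y) ρ (fun m => Ad_surjective _) P hP
  exact ⟨A, hA⟩

/-- Two lifts of a representation from `SO(3)` to `SU(2)` differ by a character. -/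
theorem exists_signTwist_eq {A A' : D.KnotGroup →* SU2} (h : Ad.comp A' = Ad.comp A) :
    ∃ s, A' = signTwist s A := by
  have h' : ∀ m, ∃ s, A' (D.meridian m) = center s * A (D.meridian m) := fun m =>
    Ad_eq_iff.1 (DFunLike.congr_fun h (D.meridian m))
  obtain ⟨z, -, hz⟩ := eq_mul_of_central fun m =>
    let ⟨s, hs⟩ := h' m
    ⟨center s, center_mem_center s, hs⟩
  obtain ⟨s, hs⟩ := h' (D.arc 0)
  have e := mul_right_cancel ((hz (D.arc 0)).symm.trans hs)
  exact ⟨s, knotHom_ext fun m => by rw [hz, e, signTwist_meridian]⟩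

theorem isTraceless_Ad_comp_iff {A : D.KnotGroup →* SU2} :
    D.IsTraceless (Ad.comp A) ↔ ∀ m, IsImaginary (A (D.meridian m)) :=
  forall_congr' fun _ => trace_Ad_iff

theorem isImaginary_meridian {A : D.KnotGroup →* SU2}
    (h : IsImaginary (A (D.meridian (D.arc 0)))) (m : D.Arc) : IsImaginary (A (D.meridian m)) := by
  obtain ⟨u, hu⟩ := isConj_iff.1 (isConj_meridian A m)
  exact hu ▸ h.conj u

theorem constHom_mem_zpowers {E : Type*} [Group E] (x : E) (g : D.KnotGroup) :
    D.constHom x g ∈ Subgroup.zpowers x :=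
  PresentedGroup.generated_by D.relators ((Subgroup.zpowers x).comap (D.constHom x))
    (fun m => by
      rw [Subgroup.mem_comap, constHom_meridian]
      exact Subgroup.mem_zpowers x) g

/-- A representation that sends all meridians to the same half turn is reducible. -/
theorem isReducible_constHom {P : SU2} (hP : IsImaginary P) :
    IsReducible (D.constHom (Ad P)) := by
  obtain ⟨u, hu⟩ := hP.exists_conj isImaginary_quatK
  have hK : Ad quatK * Ad quatK = 1 := by rw [← map_mul, isImaginary_quatK, Ad_center]
  refine ⟨Ad u, fun g => ?_⟩
  obtain ⟨k, hk⟩ := constHom_mem_zpowers (D := D) (Ad P) g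
  have e : Ad u * D.constHom (Ad P) g * (Ad u)⁻¹ = Ad quatK ^ k := by
    rw [← hk, ← hu, map_mul, map_mul, map_inv]
    exact (conj_zpow (i := k)).symm
  rw [e]
  rcases Int.even_or_odd' k with ⟨j, rfl | rfl⟩
  · refine ⟨1, one_mem _, ?_⟩
    rw [zpow_mul, zpow_two, hK, one_zpow]
    ext i j
    fin_cases i <;> fin_cases j <;> simp
  · refine ⟨-1, ?_, ?_⟩
    · rw [Matrix.mem_specialOrthogonalGroup_fin_two_iff]
      simp
    · rw [zpow_add, zpow_mul, zpow_two, hK, one_zpow, one_mul, zpow_one, Ad_quatK_coe]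
      ext i j
      fin_cases i <;> fin_cases j <;> simp

/-- The meridians of a knot are conjugate, so that they all have the same image if the image is
abelian. -/
theorem eq_constHom_of_isReducible {ρ : D.KnotGroup →* SO3} (h : IsReducible ρ) :
    ρ = D.constHom (ρ (D.meridian (D.arc 0))) := by
  obtain ⟨u, hu⟩ := h
  refine eq_constHom_of_commute fun m m' => ?_
  obtain ⟨A, hA, hm⟩ := hu (D.meridian m)
  obtain ⟨A', hA', hm'⟩ := hu (D.meridian m')
  exact (Commute.conj_iff u).1 (commute_of_rotation hA hA' hm hm')

/-- If a traceless representation is irreducible, then some meridian does not commute with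
the first one in `SU(2)`. -/
theorem exists_not_commute {A : D.KnotGroup →* SU2} (hA : D.IsTraceless (Ad.comp A))
    (hirr : ¬ IsReducible (Ad.comp A)) :
    ∃ m, ¬ Commute (A (D.meridian (D.arc 0))) (A (D.meridian m)) := by
  by_contra! h
  rw [isTraceless_Ad_comp_iff] at hA
  have e : Ad.comp A = D.constHom (Ad (A (D.meridian (D.arc 0)))) := knotHom_ext fun m => by
    rw [constHom_meridian]
    exact Ad_eq_iff.2 ((hA _).eq_of_commute (hA m) (h m))
  exact hirr (e ▸ isReducible_constHom (hA _))

/-- The centralizer in `SU(2)` of a lift of an irreducible traceless representation is `{±1}`. -/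
theorem exists_center_of_commute_all {A : D.KnotGroup →* SU2} (hA : D.IsTraceless (Ad.comp A))
    (hirr : ¬ IsReducible (Ad.comp A)) {u : SU2} (hu : ∀ m, Commute (A (D.meridian m)) u) :
    ∃ s, u = center s := by
  obtain ⟨m, hm⟩ := exists_not_commute hA hirr
  rw [isTraceless_Ad_comp_iff] at hA
  exact exists_center_of_commute (hA _) hm (hu _) (hu m)

/-- For an irreducible dihedral representation, the half turn around the axis of the dihedral group
lifts to an element of `SU(2)` that anticommutes with all meridians. -/
theorem exists_anti_of_isDihedral {A : D.KnotGroup →* SU2} (hA : D.IsTraceless (Ad.comp A))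
    (hirr : ¬ IsReducible (Ad.comp A)) (hdih : IsDihedral (Ad.comp A)) :
    ∃ B, ∀ m, Anti (A (D.meridian m)) B := by
  obtain ⟨u, hu⟩ := hdih
  obtain ⟨v, rfl⟩ := Ad_surjective u
  let K := v⁻¹ * quatK * v
  have hKim : IsImaginary K := by
    have := isImaginary_quatK.conj v⁻¹
    rwa [inv_inv] at this
  have hcomm : ∀ g, Commute (Ad K) (Ad.comp A g) := by
    intro g
    obtain ⟨M, -, hM⟩ := hu g
    have h := commute_Ad_quatK hM
    rw [← Commute.conj_iff (Ad v)]
    have e : Ad v * Ad K * (Ad v)⁻¹ = Ad quatK := by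
      rw [← map_inv, ← map_mul, ← map_mul]
      congr 1
      simp only [K]
      group
    rwa [e]
  obtain ⟨s, hs⟩ := exists_signTwist_eq (A := A) (A' := (MulAut.conj K).toMonoidHom.comp A) (by
    refine MonoidHom.ext fun g => ?_
    change Ad (K * A g * K⁻¹) = Ad (A g)
    rw [map_mul, map_mul, map_inv, mul_inv_eq_iff_eq_mul]
    exact (hcomm g).eq)
  have hs' : ∀ m, K * A (D.meridian m) * K⁻¹ = center s * A (D.meridian m) := fun m =>
    (DFunLike.congr_fun hs (D.meridian m)).trans (signTwist_meridian s A m)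
  rcases Int.units_eq_one_or s with rfl | rfl
  · obtain ⟨t, ht⟩ := exists_center_of_commute_all hA hirr (u := K) (fun m => by
      have := hs' m
      rw [map_one, one_mul, mul_inv_eq_iff_eq_mul] at this
      exact this.symm)
    rw [IsImaginary, ht, center_mul_self] at hKim
    exact absurd hKim.symm center_neg_one_ne_one
  · exact ⟨K, fun m => anti_of_conj_eq (hs' m)⟩

/-- An element that anticommutes with all meridians gives a half turn that commutes with
the representation, whose image therefore preserves the axis of this half turn. -/
theorem isDihedral_of_anti {A : D.KnotGroup →* SU2} {B : SU2}
    (h : ∀ m, Anti (A (D.meridian m)) B) : IsDihedral (Ad.comp A) := by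
  obtain ⟨v, hv⟩ := (h (D.arc 0)).isImaginary_right.exists_conj isImaginary_quatK
  have e : (MulAut.conj (Ad B)).toMonoidHom.comp (Ad.comp A) = Ad.comp A := knotHom_ext fun m => by
    change Ad B * Ad (A (D.meridian m)) * (Ad B)⁻¹ = Ad (A (D.meridian m))
    rw [← map_inv, ← map_mul, ← map_mul, (h m).conj_eq, map_mul, Ad_center, one_mul]
  refine ⟨Ad v, fun g => exists_of_commute_Ad_quatK ?_⟩
  rw [← hv, map_mul, map_mul, map_inv, Commute.conj_iff]
  have := DFunLike.congr_fun e g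
  change Ad B * Ad.comp A g * (Ad B)⁻¹ = Ad.comp A g at this
  exact mul_inv_eq_iff_eq_mul.1 this

/-! ### The fibers of `ψ` -/

variable {c : D.LinkGroup → D.LinkGroup → ℤˣ} {α : ProjRep c}

/-- The image of `ψ` consists of the traceless classes: `A(a₁)` anticommutes with some element of
`SU(2)` iff it is purely imaginary, and all meridians are conjugate to `a₁`. -/
theorem range_psi (hα : D.IsAlpha α) : Set.range (D.psi c) = D.R0 := by
  ext y
  constructor
  · rintro ⟨⟨ρ⟩, rfl⟩
    obtain ⟨A, B, h, rfl⟩ := exists_eq_rep hα ρ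
    exact ⟨Ad.comp A, isTraceless_Ad_comp_iff.2 (isImaginary_meridian h.isImaginary_left),
      (psi_rep hα h).symm⟩
  · rintro ⟨ρ, hρ, rfl⟩
    obtain ⟨A, rfl⟩ := exists_Ad_comp_eq ρ
    obtain ⟨B, hB⟩ := (isTraceless_Ad_comp_iff.1 hρ (D.arc 0)).exists_anti
    exact ⟨_, psi_rep hα hB⟩

theorem psi_smul (hα : D.IsAlpha α) (χ : D.LinkGroup →* ℤˣ) (x : PR c) :
    D.psi c (χ • x) = D.psi c x := by
  obtain ⟨ρ⟩ := x
  obtain ⟨A, B, h, rfl⟩ := exists_eq_rep hα ρ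
  rw [eq_character χ]
  change D.psi c (_ • Quotient.mk _ (rep hα A B h)) = D.psi c (Quotient.mk _ (rep hα A B h))
  rw [character_smul_rep, psi_rep, psi_rep, Ad_comp_signTwist]

theorem anti_fiber {A : D.KnotGroup →* SU2} {B : SU2}
    (h : Anti (A (D.meridian (D.arc 0))) B) (s : ℤˣ) (z : Circle) :
    Anti (signTwist s A (D.meridian (D.arc 0))) (circ h.isImaginary_left z * B) := by
  have := anti_signTwist (h.circ_mul z) s 1
  rwa [map_one, one_mul] at this

/-- The points of the fiber of `ψ` over the class of `Ad A`, parametrized by two circles: the sign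
`s` of the lift `± A` and the image of the meridian of `ℓ`, which runs through the circle of
elements that anticommute with the first meridian.  The element `B` is a base point of this
circle. -/
def fiberPoint (hα : D.IsAlpha α) {A : D.KnotGroup →* SU2} {B : SU2}
    (h : Anti (A (D.meridian (D.arc 0))) B) (s : ℤˣ) (z : Circle) : PR c :=
  Quotient.mk _ (rep hα (signTwist s A) (circ h.isImaginary_left z * B) (anti_fiber h s z))

variable (hα : D.IsAlpha α) {A : D.KnotGroup →* SU2} {B : SU2}
  (h : Anti (A (D.meridian (D.arc 0))) B)

theorem continuous_fiberPoint (s : ℤˣ) : Continuous (fiberPoint hα h s) :=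
  continuous_quotient_mk'.comp
    (continuous_rep hα _ ((continuous_circ _).mul continuous_const) _)

theorem psi_fiberPoint (s : ℤˣ) (z : Circle) :
    D.psi c (fiberPoint hα h s z) = Quotient.mk _ (Ad.comp A) := by
  rw [fiberPoint, psi_rep, Ad_comp_signTwist]

/-- As `Ad` is surjective, every point of the fiber can be conjugated so that its adjoint restricts
to `Ad A`, and then it only remains to choose the lift and the image of the meridian of `ℓ`. -/
theorem exists_fiberPoint {x : PR c} (hx : D.psi c x = Quotient.mk _ (Ad.comp A)) :
    ∃ s z, x = fiberPoint hα h s z := by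
  obtain ⟨ρ⟩ := x
  obtain ⟨A', B', h', rfl⟩ := exists_eq_rep hα ρ
  have hx := (psi_rep hα h').symm.trans hx
  rw [Quotient.eq] at hx
  obtain ⟨u, hu⟩ := hx
  obtain ⟨v, rfl⟩ := Ad_surjective u
  obtain ⟨s, hs⟩ := exists_signTwist_eq (A := A) (A' := (MulAut.conj v).toMonoidHom.comp A') (by
    refine MonoidHom.ext fun g => ?_
    rw [hu]
    change Ad (v * A' g * v⁻¹) = Ad v * Ad (A' g) * (Ad v)⁻¹
    rw [map_mul, map_mul, map_inv])
  have hs' : ∀ m, v * A' (D.meridian m) * v⁻¹ = center s * A (D.meridian m) := fun m =>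
    (DFunLike.congr_fun hs (D.meridian m)).trans (signTwist_meridian s A m)
  have hanti : Anti (A (D.meridian (D.arc 0))) (v * B' * v⁻¹) := by
    have := (h'.conj v).center_mul s 1
    rwa [hs', ← mul_assoc, center_mul_self, map_one, one_mul, one_mul] at this
  obtain ⟨z, hz⟩ := h.exists_circ hanti
  refine ⟨s, z, (mk_rep_eq_iff hα).2 ⟨v, fun m => ?_, hz.symm⟩⟩
  rw [signTwist_meridian, hs']

theorem range_fiberPoint :
    {x | ∃ s z, x = fiberPoint hα h s z} = D.psi c ⁻¹' {Quotient.mk _ (Ad.comp A)} := by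
  ext x
  refine ⟨?_, exists_fiberPoint hα h⟩
  rintro ⟨s, z, rfl⟩
  exact psi_fiberPoint hα h s z

theorem chiK_smul_fiberPoint (s : ℤˣ) (z : Circle) :
    D.chiK • fiberPoint hα h s z = fiberPoint hα h (-s) z := by
  rw [fiberPoint, chiK, character_smul_rep]
  exact congrArg (Quotient.mk _) (rep_congr hα (by rw [signTwist_signTwist, neg_one_mul])
    (by rw [map_one, one_mul]))

theorem chiL_smul_fiberPoint (s : ℤˣ) (z : Circle) :
    D.chiL • fiberPoint hα h s z = fiberPoint hα h s (-z) := by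
  rw [fiberPoint, chiL, character_smul_rep]
  exact congrArg (Quotient.mk _) (rep_congr hα (by rw [signTwist_signTwist, one_mul])
    (by rw [circ_neg, mul_assoc]))

/-- If `B` anticommutes with all meridians, then conjugation by `B` identifies the two circles. -/
theorem fiberPoint_neg (hB : ∀ m, Anti (A (D.meridian m)) B) (s : ℤˣ) (z : Circle) :
    fiberPoint hα h (-s) z = fiberPoint hα h s z⁻¹ := by
  refine (mk_rep_eq_iff hα).2 ⟨B, fun m => ?_, ?_⟩
  · have hc := (hB m).center_mul (-s) 1
    rw [map_one, one_mul] at hc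
    rw [signTwist_meridian, signTwist_meridian, hc.conj_eq, ← mul_assoc, ← map_mul, neg_one_mul,
      neg_neg]
  · rw [← mul_assoc B, h.mul_circ, mul_inv_cancel_right]

/-- Over an irreducible representation, each of the two circles embeds into the space of conjugacy
classes; conjugation can identify points on different circles only in the dihedral case. -/
theorem eq_of_fiberPoint_eq (hA : D.IsTraceless (Ad.comp A)) (hirr : ¬ IsReducible (Ad.comp A))
    {s t : ℤˣ} {z w : Circle} (hst : s = t ∨ ¬ IsDihedral (Ad.comp A))
    (he : fiberPoint hα h s z = fiberPoint hα h t w) : s = t ∧ z = w := by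
  obtain ⟨u, hu, hB⟩ := (mk_rep_eq_iff hα).1 he
  simp only [signTwist_meridian] at hu
  have hu' : ∀ m, u * A (D.meridian m) * u⁻¹ = center (s * t) * A (D.meridian m) := by
    intro m
    rw [map_mul, mul_assoc (center s), hu, ← mul_assoc u, ← center_mul_comm]
    calc u * A (D.meridian m) * u⁻¹
        = center s * center s * (u * A (D.meridian m) * u⁻¹) := by rw [center_mul_self, one_mul]
      _ = _ := by group
  have est : s = t := by
    rcases hst with e | hdih
    · exact e
    rcases Int.units_eq_one_or (s * t) with e | e
    · rw [← Int.units_inv_eq_self t]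
      exact eq_inv_of_mul_eq_one_left e
    · exact absurd (isDihedral_of_anti fun m => anti_of_conj_eq (by rw [hu', e])) hdih
  refine ⟨est, ?_⟩
  subst est
  obtain ⟨r, rfl⟩ := exists_center_of_commute_all hA hirr (u := u) (fun m => by
    have := hu' m
    rw [Int.units_mul_self, map_one, one_mul, mul_inv_eq_iff_eq_mul] at this
    exact this.symm)
  rw [center_mul_comm, mul_inv_cancel_right] at hB
  exact (circ_injective _ (mul_right_cancel hB)).symm

/-- The fiber over an irreducible dihedral representation is a single circle. -/
theorem exists_circle_of_isDihedral (hα : D.IsAlpha α) {ρ : D.KnotGroup →* SO3}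
    (hρ : D.IsTraceless ρ) (hirr : ¬ IsReducible ρ) (hdih : IsDihedral ρ) :
    (∃ h : Circle → PR c, IsEmbedding h ∧ Set.range h = D.psi c ⁻¹' {Quotient.mk _ ρ} ∧
      (∀ z, D.chiK • h z = h z⁻¹) ∧ (∀ z, D.chiL • h z = h (-z))) ∧
    {x | x ∈ D.psi c ⁻¹' {Quotient.mk _ ρ} ∧ D.chiK • x = x}.ncard = 2 := by
  obtain ⟨A, rfl⟩ := exists_Ad_comp_eq ρ
  obtain ⟨B, hB⟩ := exists_anti_of_isDihedral hρ hirr hdih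
  let h := hB (D.arc 0)
  let f : Circle → PR c := fiberPoint hα h 1
  have hinj : Function.Injective f := fun z w e =>
    (eq_of_fiberPoint_eq hα h hρ hirr (Or.inl rfl) e).2
  have hrange : Set.range f = D.psi c ⁻¹' {Quotient.mk _ (Ad.comp A)} := by
    rw [← range_fiberPoint hα h]
    ext x
    constructor
    · rintro ⟨z, rfl⟩
      exact ⟨1, z, rfl⟩
    · rintro ⟨s, z, rfl⟩
      rcases Int.units_eq_one_or s with rfl | rfl
      · exact ⟨z, rfl⟩
      · exact ⟨z⁻¹, (fiberPoint_neg hα h hB 1 z).symm⟩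
  have hK : ∀ z, D.chiK • f z = f z⁻¹ := fun z => by
    rw [chiK_smul_fiberPoint, fiberPoint_neg hα h hB]
  refine ⟨⟨f, ((continuous_fiberPoint hα h 1).isClosedEmbedding hinj).isEmbedding, hrange, hK,
    chiL_smul_fiberPoint hα h 1⟩, ?_⟩
  have e : {x | x ∈ D.psi c ⁻¹' {Quotient.mk _ (Ad.comp A)} ∧ D.chiK • x = x} = {f 1, f (-1)} := by
    rw [← hrange]
    ext x
    rw [Set.mem_insert_iff, Set.mem_singleton_iff]
    constructor
    · rintro ⟨⟨z, rfl⟩, hz⟩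
      have hz := hinj ((hK z).symm.trans hz)
      rw [inv_eq_iff_mul_eq_one] at hz
      have hz' : (z : ℂ) * z = 1 := by rw [← Circle.coe_mul, hz, Circle.coe_one]
      rcases mul_self_eq_one_iff.1 hz' with h' | h'
      · exact Or.inl (congrArg f (Circle.ext h'))
      · exact Or.inr (congrArg f (Circle.ext (by simpa using h')))
    · rintro (rfl | rfl)
      · exact ⟨⟨_, rfl⟩, by rw [hK, inv_one]⟩
      · refine ⟨⟨_, rfl⟩, ?_⟩
        rw [hK]
        congr 1
        exact Circle.ext (by simp)
  rw [e, Set.ncard_pair]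
  refine fun h' => ?_
  have := congrArg (fun z : Circle => (z : ℂ).re) (hinj h')
  norm_num at this

/-- The fiber over an irreducible representation that is not dihedral consists of two circles. -/
theorem exists_two_circles (hα : D.IsAlpha α) {ρ : D.KnotGroup →* SO3}
    (hρ : D.IsTraceless ρ) (hirr : ¬ IsReducible ρ) (hdih : ¬ IsDihedral ρ) :
    ∃ h : Circle ⊕ Circle → PR c, IsEmbedding h ∧
      Set.range h = D.psi c ⁻¹' {Quotient.mk _ ρ} ∧
      (∀ y, D.chiK • h y = h y.swap) ∧
      (∀ z, D.chiL • h (Sum.inl z) = h (Sum.inl (-z))) ∧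
      (∀ z, D.chiL • h (Sum.inr z) = h (Sum.inr (-z))) := by
  obtain ⟨A, rfl⟩ := exists_Ad_comp_eq ρ
  obtain ⟨B, h⟩ := (isTraceless_Ad_comp_iff.1 hρ (D.arc 0)).exists_anti
  let f : Circle ⊕ Circle → PR c := Sum.elim (fiberPoint hα h 1) (fiberPoint hα h (-1))
  have hcont : Continuous f :=
    (continuous_fiberPoint hα h 1).sumElim (continuous_fiberPoint hα h (-1))
  have key := fun {s t : ℤˣ} {z w : Circle} =>
    eq_of_fiberPoint_eq hα h hρ hirr (s := s) (t := t) (z := z) (w := w) (Or.inr hdih)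
  have hinj : Function.Injective f := by
    rintro (z | z) (w | w) e
    · rw [(key e).2]
    · exact absurd (key e).1 (by decide)
    · exact absurd (key e).1 (by decide)
    · rw [(key e).2]
  refine ⟨f, (hcont.isClosedEmbedding hinj).isEmbedding, ?_, ?_, chiL_smul_fiberPoint hα h 1,
    chiL_smul_fiberPoint hα h (-1)⟩
  · rw [← range_fiberPoint hα h]
    ext x
    constructor
    · rintro ⟨z | z, rfl⟩
      · exact ⟨1, z, rfl⟩
      · exact ⟨-1, z, rfl⟩
    · rintro ⟨s, z, rfl⟩
      rcases Int.units_eq_one_or s with rfl | rfl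
      · exact ⟨Sum.inl z, rfl⟩
      · exact ⟨Sum.inr z, rfl⟩
  · rintro (z | z)
    · exact chiK_smul_fiberPoint hα h 1 z
    · exact (chiK_smul_fiberPoint hα h (-1) z).trans (by rw [neg_neg]; rfl)

/-- Traceless reducible representations are conjugate: they send all meridians to the same half
turn. -/
theorem mk_eq_of_isReducible {ρ : D.KnotGroup →* SO3} (hρ : D.IsTraceless ρ)
    (hred : IsReducible ρ) :
    (Quotient.mk _ ρ : Quotient (conjSO3 D.KnotGroup)) =
      Quotient.mk _ (Ad.comp (D.constHom quatI)) := by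
  obtain ⟨A, rfl⟩ := exists_Ad_comp_eq ρ
  obtain ⟨u, hu⟩ := (isTraceless_Ad_comp_iff.1 hρ (D.arc 0)).exists_conj isImaginary_quatI
  refine Quotient.sound ⟨Ad u, fun g => ?_⟩
  have e : (MulAut.conj (Ad u)).toMonoidHom.comp (Ad.comp A) = Ad.comp (D.constHom quatI) := by
    rw [eq_constHom_of_isReducible hred]
    refine knotHom_ext fun m => ?_
    change Ad u * D.constHom _ (D.meridian m) * (Ad u)⁻¹ = Ad (D.constHom quatI (D.meridian m))
    rw [constHom_meridian, constHom_meridian, ← hu, map_mul, map_mul, map_inv]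
    rfl
  exact (DFunLike.congr_fun e g).symm

/-- The fiber over the reducible representation is a point: conjugation by the circle of `i`
acts transitively on the circle of elements that anticommute with `i`. -/
theorem fiber_constHom (hα : D.IsAlpha α) :
    D.psi c ⁻¹' {Quotient.mk _ (Ad.comp (D.constHom quatI))} = {(Quotient.mk _ α : PR c)} := by
  have hB : ∀ m, Anti (D.constHom quatI (D.meridian m)) quatJ := fun m => by
    rw [constHom_meridian]
    exact anti_quatI_quatJ
  have h := hB (D.arc 0)
  have h1 : fiberPoint hα h 1 1 = Quotient.mk _ α := by
    conv_rhs => rw [alpha_eq_rep hα]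
    exact congrArg (Quotient.mk _) (rep_congr hα (signTwist_one _) (by rw [map_one, one_mul]))
  have h2 : ∀ z, fiberPoint hα h 1 z = fiberPoint hα h 1 1 := by
    intro z
    obtain ⟨t, rfl⟩ := Circle.exp_surjective z
    let w := Circle.exp (t / 2)
    have hw : Circle.exp t = w * w := by rw [← Circle.exp_add, add_halves]
    refine ((mk_rep_eq_iff hα).2 ⟨circ h.isImaginary_left w, fun m => ?_, ?_⟩).symm
    · have hc := commute_circ h.isImaginary_left w
      have hm : D.constHom quatI (D.meridian m) = D.constHom quatI (D.meridian (D.arc 0)) := by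
        rw [constHom_meridian, constHom_meridian]
      rw [signTwist_one, hm, ← hc.eq, mul_inv_cancel_right]
    · rw [map_one, one_mul, ← map_inv, mul_assoc, h.mul_circ, inv_inv, ← mul_assoc, ← map_mul, hw]
  rw [← range_fiberPoint hα h]
  ext x
  rw [Set.mem_singleton_iff]
  constructor
  · rintro ⟨s, z, rfl⟩
    rcases Int.units_eq_one_or s with rfl | rfl
    · rw [h2, h1]
    · rw [fiberPoint_neg hα h hB, h2, h1]
  · rintro rfl
    exact ⟨1, 1, h1.symm⟩

end PreDiagram

end KnotHopf

end

theorem mainTheorem6 (D : KnotHopf.KnotDiagram) :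
    (∃ e : (D.LinkGroup →* ℤˣ) ≃* ℤˣ × ℤˣ, e D.chiK = (-1, 1) ∧ e D.chiL = (1, -1)) ∧
    (∃ c : D.LinkGroup → D.LinkGroup → ℤˣ, KnotHopf.IsNontrivialCocycle c) ∧
    (∀ c c' : D.LinkGroup → D.LinkGroup → ℤˣ, KnotHopf.IsNontrivialCocycle c →
      KnotHopf.IsNontrivialCocycle c' → KnotHopf.Cohomologous c c') ∧
    ∀ c : D.LinkGroup → D.LinkGroup → ℤˣ, KnotHopf.IsNontrivialCocycle c →
      (∀ χ : D.LinkGroup →* ℤˣ, Continuous fun x : KnotHopf.PR c => χ • x) ∧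
      (∀ (χ : D.LinkGroup →* ℤˣ) (x : KnotHopf.PR c), D.psi c (χ • x) = D.psi c x) ∧
      Set.range (D.psi c) = D.R0 ∧
      -- (a) the reducible
      (∃ ρ₀ : D.KnotGroup →* KnotHopf.SO3, D.IsTraceless ρ₀ ∧ KnotHopf.IsReducible ρ₀ ∧
        (∀ ρ₁ : D.KnotGroup →* KnotHopf.SO3, D.IsTraceless ρ₁ → KnotHopf.IsReducible ρ₁ →
          (Quotient.mk _ ρ₁ : Quotient (KnotHopf.conjSO3 D.KnotGroup)) = Quotient.mk _ ρ₀) ∧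
        (∃ α : KnotHopf.ProjRep c, D.IsAlpha α) ∧
        ∀ α : KnotHopf.ProjRep c, D.IsAlpha α →
          D.psi c ⁻¹' {Quotient.mk _ ρ₀} = {(Quotient.mk _ α : KnotHopf.PR c)} ∧
          D.chiK • (Quotient.mk _ α : KnotHopf.PR c) = Quotient.mk _ α ∧
          D.chiL • (Quotient.mk _ α : KnotHopf.PR c) = Quotient.mk _ α) ∧
      -- (b) the dihedral irreducibles
      (∀ ρ₀ : D.KnotGroup →* KnotHopf.SO3, D.IsTraceless ρ₀ → ¬ KnotHopf.IsReducible ρ₀ →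
        KnotHopf.IsDihedral ρ₀ →
        (∃ h : Circle → KnotHopf.PR c, IsEmbedding h ∧
          Set.range h = D.psi c ⁻¹' {Quotient.mk _ ρ₀} ∧
          (∀ z, D.chiK • h z = h z⁻¹) ∧ (∀ z, D.chiL • h z = h (-z))) ∧
        {x | x ∈ D.psi c ⁻¹' {Quotient.mk _ ρ₀} ∧ D.chiK • x = x}.ncard = 2) ∧
      -- (c) the other irreducibles
      (∀ ρ₀ : D.KnotGroup →* KnotHopf.SO3, D.IsTraceless ρ₀ → ¬ KnotHopf.IsReducible ρ₀ →
        ¬ KnotHopf.IsDihedral ρ₀ →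
        ∃ h : Circle ⊕ Circle → KnotHopf.PR c, IsEmbedding h ∧
          Set.range h = D.psi c ⁻¹' {Quotient.mk _ ρ₀} ∧
          (∀ y, D.chiK • h y = h y.swap) ∧
          (∀ z, D.chiL • h (Sum.inl z) = h (Sum.inl (-z))) ∧
          (∀ z, D.chiL • h (Sum.inr z) = h (Sum.inr (-z)))) := by
  open KnotHopf PreDiagram in
  refine ⟨⟨characterEquiv _, ?_, ?_⟩, exists_nontrivialCocycle,
    fun c c' => cohomologous_of_nontrivial, fun c hc => ?_⟩
  · exact Prod.ext (character_linkMeridian _ _ _) (character_hopfMeridian _ _)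
  · exact Prod.ext (character_linkMeridian _ _ _) (character_hopfMeridian _ _)
  obtain ⟨α₀, hα₀⟩ := exists_isAlpha hc
  have hred : Ad.comp (D.constHom quatI) = D.constHom (Ad quatI) :=
    knotHom_ext fun m => by simp
  refine ⟨continuous_character_smul, psi_smul hα₀, range_psi hα₀,
    ⟨Ad.comp (D.constHom quatI), ?_, hred ▸ isReducible_constHom isImaginary_quatI,
      fun ρ₁ => mk_eq_of_isReducible, ⟨α₀, hα₀⟩, fun α hα => ⟨fiber_constHom hα, ?_⟩⟩,
    fun ρ₀ => exists_circle_of_isDihedral hα₀, fun ρ₀ => exists_two_circles hα₀⟩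
  · exact isTraceless_Ad_comp_iff.2 fun m => by
      rw [constHom_meridian]
      exact isImaginary_quatI
  · -- The characters preserve the fiber, which is a point.
    have key : ∀ χ : D.LinkGroup →* ℤˣ,
        χ • (Quotient.mk _ α : PR c) = Quotient.mk _ α := fun χ => by
      have h : (Quotient.mk _ α : PR c) ∈
          D.psi c ⁻¹' {Quotient.mk _ (Ad.comp (D.constHom quatI))} := by
        rw [fiber_constHom hα]
        exact Set.mem_singleton _
      have h' : χ • (Quotient.mk _ α : PR c) ∈
          D.psi c ⁻¹' {Quotient.mk _ (Ad.comp (D.constHom quatI))} := by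
        rw [Set.mem_preimage, psi_smul hα]
        exact h
      rwa [fiber_constHom hα] at h'
    exact ⟨key _, key _⟩
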